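/- Proposition (Thermodynamic Hierarchy). **Setting.** Let $\beta>0$, let $H$ be a Hermitian matrix on $\mathbb C^d$, $Z=\operatorname{tr}e^{-\beta H}$, $\gamma=e^{-\beta H}/Z$, $f_{\rm eq}=-\beta^{-1}\ln Z$, and let $\mathrm D(\rho\|\sigma)=\operatorname{tr}\rho(\ln\rho-\ln\sigma)\in[0,\infty]$ be the quantum relative entropy ($+\infty$ if $\operatorname{supp}\rho\not\subseteq\operatorname{supp}\sigma$). Consider a classical hidden Markov model with finitely many latent states, a finite alphabet $\mathcal X$, non-negative matrices $T^{(x)}$ with $\sum_xT^{(x)}$ stochastic, and initial distribution $\eta_0$ (a row vector), which emits a density matrix $\sigma^{(x)}$ on $\mathbb C^d$ with each symbol $x$. Put $\Pr(x_{1:T})=\eta_0T^{(x_1)}\cdots T^{(x_T)}\mathbf 1$, $$\rho^{(1:T)}=\sum_{x_{1:T}}\Pr(x_{1:T})\bigotimes_{t=1}^T\sigma^{(x_t)},\qquad F_{\rm eq}^{(1:T)}=T f_{\rm eq},\qquad F_{\rm noneq}^{(1:T)}=F_{\rm eq}^{(1:T)}+\beta^{-1}\mathrm D\big(\rho^{(1:T)}\,\big\|\,\gamma^{\otimes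 T}\big).$$ **Agent.** A belief state is a probability vector $\eta$ on the latent states; write $\xi_\eta=\sum_x(\eta T^{(x)}\mathbf 1)\,\sigma^{(x)}$. An action $a$ is an orthonormal basis $(\psi_i)$ together with a probability vector $(\lambda_i)$; its tailored state is $\rho_a=\sum_i\lambda_i|\psi_i\rangle\langle\psi_i|$, and the expected work that it yields in belief state $\eta$ is $r(\eta,a)=\beta^{-1}[\mathrm D(\xi_\eta\|\gamma)-\mathrm D(\xi_\eta\|\rho_a)]\in[-\infty,\infty)$. On a subsystem in state $\sigma$, outcome $i$ occurs with probability $\langle\psi_i|\sigma|\psi_i\rangle$, and the belief state is updated by Bayes' rule, $\eta\mapsto\sum_x\langle\psi_i|\sigma^{(x)}|\psi_i\rangle\,\eta T^{(x)}/\sum_x\langle\psi_i|\sigma^{(x)}|\psi_i\rangle\,\eta T^{(x)}\mathbf 1$. A policy $\Lambda$ gives, for each step $t$, the action $A_t=\Lambda_t(K_{t-1})$ as a function of the current belief state, where $K_0=\eta_0$. With outcomes distributed as in the sequential processing of $\rho^{(1:T)}$, put $$W(T,\Lambda)=\mathbb E_\Lambda\sum_{t=1}^T r(K_{t-1},A_t),\qquad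 F_{\rm TO}^{(1:T)}=\sup_\Lambda W(T,\Lambda),\qquad w(\Lambda)=\limsup_{T\to\infty}\tfrac1TW(T,\Lambda)$$ (the limit, when it exists). A policy $\Lambda_{\rm LO}$ is locally optimizing if at every step and in every belief state it chooses an action minimizing $\mathrm D(\xi_\eta\|\rho_a)$. For a horizon $T$, let $V_{T+1}=0$ and $V_t(\eta)=\sup_aJ_t(\eta,a)$, where $J_t(\eta,a)$ is $r(\eta,a)$ plus the expectation of $V_{t+1}$ at the updated belief state; a policy $\Lambda^*$ is a dynamic-programming policy for horizon $T$ if, for every $t\le T$ and every belief state $\eta$, the action $\Lambda^*_t(\eta)$ maximizes $J_t(\eta,\cdot)$. **Claim.** 1. Locally optimizing policies exist. For every $T$, dynamic-programming policies for horizon $T$ exist, and for every such policy $\Lambda^*$ and every locally optimizing policy $\Lambda_{\rm LO}$, $$F_{\rm noneq}^{(1:T)}-F_{\rm eq}^{(1:T)}\ \ge\ F_{\rm TO}^{(1:T)}=W(T,\Lambda^*)\ \ge\ W(T,\Lambda_{\rm LO}).$$ 2. If $\eta_0$ is stationary, $\eta_0\sum_xT^{(x)}=\eta_0$, then the limits $f_{\rm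 noneq}=\lim_T\frac1TF_{\rm noneq}^{(1:T)}$ and $f_{\rm TO}=\lim_T\frac1TF_{\rm TO}^{(1:T)}$ exist and are finite. If $\Lambda^{*,T}$ is a dynamic-programming policy for horizon $T$ for each $T$, then $\frac1TW(T,\Lambda^{*,T})\to f_{\rm TO}$. There is a policy $\Lambda^*$ that maximizes $w$ over all policies and for which $\frac1TW(T,\Lambda^*)\to f_{\rm TO}$. For every policy $\Lambda^*$ that maximizes $w$ and every locally optimizing policy $\Lambda_{\rm LO}$, $$f_{\rm noneq}-f_{\rm eq}\ \ge\ f_{\rm TO}=w(\Lambda^*)\ \ge\ w(\Lambda_{\rm LO}).$$ 3. If $\Lambda$ is a time-independent policy with $W(T,\Lambda)>-\infty$ for all $T$, whose belief process $K_t$ stays in a finite set of belief states and converges in law to a limiting distribution $\mu$ on it, then $\frac1TW(T,\Lambda)\to\beta^{-1}\,\mathbb E_{\eta\sim\mu}\big[\mathrm D(\xi_\eta\|\gamma)-\mathrm D(\xi_\eta\|\rho_{\Lambda(\eta)})\big]$, and hence $w(\Lambda)$ is this value. If energies are measured so that the equilibrium free energy vanishes ($Z=1$), the two chains read $F_{\rm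 noneq}^{(1:T)}\ge F_{\rm TO}^{(1:T)}=W(T,\Lambda^*)\ge W(T,\Lambda_{\rm LO})$ and $f_{\rm noneq}\ge f_{\rm TO}=w(\Lambda^*)\ge w(\Lambda_{\rm LO})$. -/

import Mathlib

open scoped Matrix Topology ComplexOrder
open Filter

namespace TimeOrderedWork

noncomputable section

/-! ## Finite-dimensional quantum states -/

/-- Density matrices: positive semidefinite with unit trace. -/
def IsDensity {ι : Type*} [Fintype ι] (ρ : Matrix ι ι ℂ) : Prop :=
  ρ.PosSemidef ∧ ρ.trace = 1

/-- Tensor product `A_1 ⊗ ⋯ ⊗ A_T`, a matrix indexed by the product basis `Fin T → ι`. -/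
def tensor {ι : Type*} {T : ℕ} (A : Fin T → Matrix ι ι ℂ) :
    Matrix (Fin T → ι) (Fin T → ι) ℂ :=
  Matrix.of fun i j => ∏ t, A t (i t) (j t)

/-- Matrix logarithm of a Hermitian matrix by spectral calculus (with `log 0 = 0`). -/
def matLog {ι : Type*} [Fintype ι] [DecidableEq ι] (A : Matrix ι ι ℂ) : Matrix ι ι ℂ :=
  cfc Real.log A

open Classical in
/-- Umegaki relative entropy `D(ρ‖σ) = tr ρ (ln ρ - ln σ)` if the support of `ρ` is contained in
that of `σ` (that is, `ker σ ⊆ ker ρ`), and `+∞` otherwise. -/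
def relEntropy {ι : Type*} [Fintype ι] [DecidableEq ι] (ρ σ : Matrix ι ι ℂ) : EReal :=
  if ∀ v : ι → ℂ, σ *ᵥ v = 0 → ρ *ᵥ v = 0 then
    (((ρ * (matLog ρ - matLog σ)).trace.re : ℝ) : EReal)
  else ⊤

/-- The Boltzmann operator `e^{-βH}` of a Hermitian matrix `H`. -/
def boltzmann {ι : Type*} [Fintype ι] [DecidableEq ι] (β : ℝ) (H : Matrix ι ι ℂ) :
    Matrix ι ι ℂ :=
  cfc (fun e : ℝ => Real.exp (-(β * e))) H

/-- The partition function `Z = tr e^{-βH}`. -/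
def partitionFunction {ι : Type*} [Fintype ι] [DecidableEq ι] (β : ℝ) (H : Matrix ι ι ℂ) : ℝ :=
  (boltzmann β H).trace.re

/-- The thermal state `γ = e^{-βH} / Z`. -/
def gibbs {ι : Type*} [Fintype ι] [DecidableEq ι] (β : ℝ) (H : Matrix ι ι ℂ) : Matrix ι ι ℂ :=
  (((partitionFunction β H)⁻¹ : ℝ) : ℂ) • boltzmann β H

/-- Equilibrium free energy `-β⁻¹ ln Z` of one subsystem. -/
def eqFreeEnergy {ι : Type*} [Fintype ι] [DecidableEq ι] (β : ℝ) (H : Matrix ι ι ℂ) : ℝ :=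
  -(β⁻¹ * Real.log (partitionFunction β H))

/-! ## Quantum states emitted by a classical hidden Markov model -/

/-- A classical hidden Markov model with latent states `S` and alphabet `X`, emitting the quantum
state `emit x` with each symbol `x`.  `trans x s s'` is the probability, given the latent state
`s`, to emit `x` and move to `s'`; `init` is the initial distribution of the latent state. -/
structure QuantumHMM (S X ι : Type*) [Fintype S] [Fintype X] [Fintype ι] where
  trans : X → Matrix S S ℝ
  trans_nonneg : ∀ x s s', 0 ≤ trans x s s'
  trans_sum : ∀ s, ∑ x, ∑ s', trans x s s' = 1
  init : S → ℝ
  init_mem : init ∈ stdSimplex ℝ S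
  emit : X → Matrix ι ι ℂ
  emit_density : ∀ x, IsDensity (emit x)

/-- An action: the `ρ*`-ideal extraction protocol tailored to the state with orthonormal
eigenbasis given by the columns of the unitary `basis` and eigenvalues `weight`. -/
structure Action (ι : Type*) [Fintype ι] [DecidableEq ι] where
  basis : Matrix.unitaryGroup ι ℂ
  weight : ι → ℝ
  weight_mem : weight ∈ stdSimplex ℝ ι

namespace Action

variable {ι : Type*} [Fintype ι] [DecidableEq ι]

/-- The tailored state `∑ᵢ λᵢ |ψᵢ⟩⟨ψᵢ|`. -/
def state (a : Action ι) : Matrix ι ι ℂ :=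
  (a.basis : Matrix ι ι ℂ) * Matrix.diagonal (fun i => (a.weight i : ℂ)) *
    (a.basis : Matrix ι ι ℂ)ᴴ

/-- The rank-one projector `|ψᵢ⟩⟨ψᵢ|` onto the `i`-th vector of the eigenbasis. -/
def proj (a : Action ι) (i : ι) : Matrix ι ι ℂ :=
  Matrix.vecMulVec (fun k => (a.basis : Matrix ι ι ℂ) k i)
    (fun k => star ((a.basis : Matrix ι ι ℂ) k i))

/-- The probability `⟨ψᵢ|ρ|ψᵢ⟩` of the `i`-th work outcome on input state `ρ`. -/
def outcome (a : Action ι) (ρ : Matrix ι ι ℂ) (i : ι) : ℝ :=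
  (a.proj i * ρ).trace.re

end Action

/-- A (deterministic, possibly time-dependent) policy: the action chosen at each time step as a
function of the current belief state.  The step with index `t : ℕ` is the `(t+1)`-st one. -/
abbrev Policy (S ι : Type*) [Fintype ι] [DecidableEq ι] := ℕ → (S → ℝ) → Action ι

namespace QuantumHMM

variable {S X ι : Type*} [Fintype S] [DecidableEq S] [Fintype X] [Fintype ι] [DecidableEq ι]

/-- `Pr(x_{1:T}) = η₀ T^{(x_1)} ⋯ T^{(x_T)} 1`. -/
def wordProb (Q : QuantumHMM S X ι) {T : ℕ} (x : Fin T → X) : ℝ :=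
  (Q.init ᵥ* (List.ofFn fun t => Q.trans (x t)).prod) ⬝ᵥ 1

/-- `ρ^{(1:T)} = ∑ Pr(x_{1:T}) σ^{(x_1)} ⊗ ⋯ ⊗ σ^{(x_T)}`. -/
def multiTimeState (Q : QuantumHMM S X ι) (T : ℕ) : Matrix (Fin T → ι) (Fin T → ι) ℂ :=
  ∑ x : Fin T → X, (Q.wordProb x : ℂ) • tensor fun t => Q.emit (x t)

/-- The initial distribution of the latent state is stationary. -/
def IsStationary (Q : QuantumHMM S X ι) : Prop :=
  Q.init ᵥ* (∑ x, Q.trans x) = Q.init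

/-- The distribution `P_x = η T^{(x)} 1` of the next symbol induced by the belief state `η`. -/
def symbolProb (Q : QuantumHMM S X ι) (η : S → ℝ) (x : X) : ℝ :=
  (η ᵥ* Q.trans x) ⬝ᵥ 1

/-- The expected state `ξ_η = ∑ₓ P_x σ^{(x)}`. -/
def expectedState (Q : QuantumHMM S X ι) (η : S → ℝ) : Matrix ι ι ℂ :=
  ∑ x, (Q.symbolProb η x : ℂ) • Q.emit x

/-- Bayesian update of the belief state `η` after outcome `i` of action `a`. -/
def update (Q : QuantumHMM S X ι) (η : S → ℝ) (a : Action ι) (i : ι) : S → ℝ :=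
  (∑ x, a.outcome (Q.emit x) i * Q.symbolProb η x)⁻¹ •
    ∑ x, a.outcome (Q.emit x) i • (η ᵥ* Q.trans x)

/-- The expected immediate dissipation (in units of `β⁻¹`) of action `a` in belief state `η`. -/
def dissipation (Q : QuantumHMM S X ι) (η : S → ℝ) (a : Action ι) : EReal :=
  relEntropy (Q.expectedState η) a.state

/-- The expected work `r(η,a) = β⁻¹ [D(ξ_η‖γ) - D(ξ_η‖ρ_a)]` extracted in one step
(`-∞` if the support of `ξ_η` is not contained in that of the tailored state). -/
def reward (Q : QuantumHMM S X ι) (β : ℝ) (H : Matrix ι ι ℂ) (η : S → ℝ) (a : Action ι) : EReal :=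
  ((β⁻¹ : ℝ) : EReal) * (relEntropy (Q.expectedState η) (gibbs β H) - Q.dissipation η a)

/-- The belief state `K_t` of an agent with policy `Λ` after the outcomes `o_{1:t}`. -/
def belief (Q : QuantumHMM S X ι) (Λ : Policy S ι) : (t : ℕ) → (Fin t → ι) → S → ℝ
  | 0, _ => Q.init
  | t + 1, o =>
    Q.update (Q.belief Λ t (Fin.init o)) (Λ t (Q.belief Λ t (Fin.init o))) (o (Fin.last t))

/-- The action taken at step `s` along the outcome history `o`. -/
def actionAt (Q : QuantumHMM S X ι) (Λ : Policy S ι) {t : ℕ} (o : Fin t → ι) (s : Fin t) :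
    Action ι :=
  Λ s (Q.belief Λ s fun k => o ⟨k, k.2.trans s.2⟩)

/-- The probability of the outcomes `o_{1:t}` when the subsystems of `ρ^{(1:t)}` are processed one
after the other, each action depending on the previous outcomes as prescribed by `Λ`. -/
def historyProb (Q : QuantumHMM S X ι) (Λ : Policy S ι) {t : ℕ} (o : Fin t → ι) : ℝ :=
  ((tensor fun s => (Q.actionAt Λ o s).proj (o s)) * Q.multiTimeState t).trace.re

/-- The expected cumulative work `W(T,Λ) = 𝔼_Λ ∑_{t=1}^T r(K_{t-1}, Λ_t(K_{t-1}))`. -/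
def work (Q : QuantumHMM S X ι) (β : ℝ) (H : Matrix ι ι ℂ) (T : ℕ) (Λ : Policy S ι) : EReal :=
  ∑ t ∈ Finset.range T, ∑ o : Fin t → ι,
    (Q.historyProb Λ o : EReal) * Q.reward β H (Q.belief Λ t o) (Λ t (Q.belief Λ t o))

/-- Asymptotic work-extraction rate `w(Λ)` of a policy: the limit of `W(T,Λ)/T` if it exists, and
the limit superior in general. -/
def workRate (Q : QuantumHMM S X ι) (β : ℝ) (H : Matrix ι ι ℂ) (Λ : Policy S ι) : EReal :=
  limsup (fun T : ℕ => Q.work β H T Λ / (T : EReal)) atTop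

/-- Time-ordered free energy: the supremum of the cumulative work over all policies. -/
def timeOrderedFreeEnergy (Q : QuantumHMM S X ι) (β : ℝ) (H : Matrix ι ι ℂ) (T : ℕ) : EReal :=
  ⨆ Λ : Policy S ι, Q.work β H T Λ

/-- Non-equilibrium free energy `F_eq + β⁻¹ D(ρ^{(1:T)}‖γ^{⊗T})` of the multi-time state, where
`F_eq = T · (-β⁻¹ ln Z)` is the equilibrium free energy of `T` subsystems. -/
def noneqFreeEnergy (Q : QuantumHMM S X ι) (β : ℝ) (H : Matrix ι ι ℂ) (T : ℕ) : EReal :=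
  ((T * eqFreeEnergy β H : ℝ) : EReal) +
    ((β⁻¹ : ℝ) : EReal) * relEntropy (Q.multiTimeState T) (tensor fun _ => gibbs β H)

/-- The objective `r(η,a) + 𝔼[V(K') | K = η, a]` for a continuation value function `V`. -/
def objective (Q : QuantumHMM S X ι) (β : ℝ) (H : Matrix ι ι ℂ) (V : (S → ℝ) → EReal)
    (η : S → ℝ) (a : Action ι) : EReal :=
  Q.reward β H η a + ∑ i, (a.outcome (Q.expectedState η) i : EReal) * V (Q.update η a i)

/-- The value function computed by backward induction, with `n` steps remaining. -/
def dpValue (Q : QuantumHMM S X ι) (β : ℝ) (H : Matrix ι ι ℂ) : ℕ → (S → ℝ) → EReal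
  | 0, _ => 0
  | n + 1, η => ⨆ a : Action ι, Q.objective β H (Q.dpValue β H n) η a

/-- `Λ` is an optimal policy produced by backward induction with horizon `T`: at every step and in
every belief state it selects an action that maximizes the objective. -/
def IsDPPolicy (Q : QuantumHMM S X ι) (β : ℝ) (H : Matrix ι ι ℂ) (T : ℕ) (Λ : Policy S ι) : Prop :=
  ∀ t < T, ∀ η ∈ stdSimplex ℝ S, ∀ a : Action ι,
    Q.objective β H (Q.dpValue β H (T - 1 - t)) η a ≤
      Q.objective β H (Q.dpValue β H (T - 1 - t)) η (Λ t η)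

/-- `Λ` is locally optimizing: at every step and in every belief state it selects an action that
minimizes the expected immediate dissipation. -/
def IsLocallyOptimizing (Q : QuantumHMM S X ι) (Λ : Policy S ι) : Prop :=
  ∀ t, ∀ η ∈ stdSimplex ℝ S, ∀ a : Action ι, Q.dissipation η (Λ t η) ≤ Q.dissipation η a

/-- `Λ` maximizes the asymptotic work-extraction rate among all policies. -/
def IsRateOptimal (Q : QuantumHMM S X ι) (β : ℝ) (H : Matrix ι ι ℂ) (Λ : Policy S ι) : Prop :=
  ∀ Λ' : Policy S ι, Q.workRate β H Λ' ≤ Q.workRate β H Λ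

open Classical in
/-- The probability `Pr(K_t = η)`. -/
def beliefLaw (Q : QuantumHMM S X ι) (Λ : Policy S ι) (t : ℕ) (η : S → ℝ) : ℝ :=
  ∑ o : Fin t → ι, if Q.belief Λ t o = η then Q.historyProb Λ o else 0

/-- Under the policy `Λ` the belief process stays in the finite set `B`, and its law converges to
the limiting distribution `μ` on `B`. -/
def HasLimitingBeliefs (Q : QuantumHMM S X ι) (Λ : Policy S ι) (B : Finset (S → ℝ))
    (μ : (S → ℝ) → ℝ) : Prop :=
  (∀ t η, η ∉ B → Q.beliefLaw Λ t η = 0) ∧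
    ∀ η ∈ B, Tendsto (fun t => Q.beliefLaw Λ t η) atTop (𝓝 (μ η))

end QuantumHMM

end

end TimeOrderedWork

set_option linter.unusedSectionVars false

/-! Once the basis of an action is fixed, Gibbs' inequality makes the expected outcome probabilities
the best weights, so only the basis, a point of the compact unitary group, remains to be optimized.
Belief states are replaced by unnormalized vectors whose mass is the probability of the history that
led to them. A measurement outcome then acts linearly (`branch`), and the tuned one-step work
(`gain`) and the optimal `n`-step work (`value`) are continuous and positively homogeneous. Hence
maxima are attained, the extended-real Bellman recursion is real-valued on belief states
(`dpValue_eq_value`), and telescoping it along the tree of histories identifies the time-ordered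
free energy, `value`, and the work of any dynamic-programming policy.

For the bound by the free energy, the gains along a policy telescope by the chain rule to `β⁻¹`
times the mean energy minus the Shannon entropy of the outcome record (`sum_stepGain`). That record
is one measurement of the multi-time state in an orthonormal basis of product vectors (`treeBasis`),
and by Klein's inequality (`sum_outcome_mul_log_le`) its entropy is at least the von Neumann
entropy.

The rates come from Fekete's lemma, used twice. The entropy of the multi-time state is subadditive
in `T`, by Klein's inequality against the product of the marginals. Moreover `value` is subadditive
in the belief (`value_add_le`): information never hurts. Under stationarity the weighted beliefs at
any time sum to the initial one, so `value` is superadditive in the horizon. A single policy attains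
the limit by planning optimally in blocks `[k², (k+1)²)`, whose lengths grow but are negligible
against the elapsed time. The comparison with locally optimizing policies only uses that they are
policies. -/

namespace TimeOrderedWork

/-! ### Functional calculus in an eigenbasis and Born probabilities. -/

section Spectral

variable {κ : Type*} [Fintype κ] [DecidableEq κ]

theorem aeval_diagonal_ofReal (q : Polynomial ℝ) (l : κ → ℝ) :
    Polynomial.aeval (Matrix.diagonal fun i => (l i : ℂ)) q =
      Matrix.diagonal fun i => ((q.eval (l i) : ℝ) : ℂ) := by
  have h1 := Polynomial.aeval_algHom_apply (Matrix.diagonalAlgHom (n := κ) (α := ℂ) ℝ)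
    (fun i => (l i : ℂ)) q
  rw [Matrix.diagonalAlgHom_apply] at h1
  rw [h1, Matrix.diagonalAlgHom_apply]
  congr 1
  funext i
  have h2 := Polynomial.aeval_algHom_apply (Pi.evalAlgHom ℝ (fun _ : κ => ℂ) i)
    (fun i => (l i : ℂ)) q
  have h3 := Polynomial.aeval_algebraMap_apply ℂ (l i) q
  simp only [Pi.evalAlgHom_apply] at h2
  rw [← h2]
  simpa using h3

theorem isHermitian_conj_diagonal (U : Matrix.unitaryGroup κ ℂ) (l : κ → ℝ) :
    ((U : Matrix κ κ ℂ) * Matrix.diagonal (fun i => (l i : ℂ)) *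
      (U : Matrix κ κ ℂ)ᴴ).IsHermitian := by
  have : (Matrix.diagonal fun i => (l i : ℂ)).IsHermitian := by
    rw [Matrix.isHermitian_diagonal_iff]
    intro i
    simp [isSelfAdjoint_iff]
  exact Matrix.isHermitian_mul_mul_conjTranspose _ this

/-- The functional calculus of a unitarily diagonalized matrix acts on the diagonal. -/
theorem cfc_conj_diagonal (f : ℝ → ℝ) (U : Matrix.unitaryGroup κ ℂ) (l : κ → ℝ) :
    cfc f ((U : Matrix κ κ ℂ) * Matrix.diagonal (fun i => (l i : ℂ)) * (U : Matrix κ κ ℂ)ᴴ) =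
      (U : Matrix κ κ ℂ) * Matrix.diagonal (fun i => (f (l i) : ℂ)) * (U : Matrix κ κ ℂ)ᴴ := by
  set A := (U : Matrix κ κ ℂ) * Matrix.diagonal (fun i => (l i : ℂ)) * (U : Matrix κ κ ℂ)ᴴ with hA
  have hAh : A.IsHermitian := isHermitian_conj_diagonal U l
  classical
  -- Interpolate `f` by a polynomial on a finite set containing both the spectrum of `A` and the
  -- diagonal entries. Polynomials commute with conjugation, and including both sets avoids having
  -- to identify them.
  have hfin : (spectrum ℝ A ∪ Set.range l).Finite :=
    (Matrix.finite_real_spectrum).union (Set.finite_range l)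
  set s := hfin.toFinset with hs
  set q := Lagrange.interpolate s id f with hq
  have hev : ∀ x ∈ s, q.eval x = f x := fun x hx =>
    Lagrange.eval_interpolate_at_node (v := id) f Function.injective_id.injOn hx
  have h1 : cfc f A = cfc (fun x => q.eval x) A := by
    apply cfc_congr
    intro x hx
    exact (hev x (by simp [hs, hx])).symm
  rw [h1, cfc_polynomial (ha := hAh.isSelfAdjoint)]
  have h2 : A = Unitary.conjStarAlgAut ℝ (Matrix κ κ ℂ) U
      (Matrix.diagonal fun i => (l i : ℂ)) := by
    simp [hA, Unitary.conjStarAlgAut_apply, Matrix.star_eq_conjTranspose]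
  have h3 := Polynomial.aeval_algHom_apply
    (Unitary.conjStarAlgAut ℝ (Matrix κ κ ℂ) U).toAlgEquiv.toAlgHom
      (Matrix.diagonal fun i => (l i : ℂ)) q
  rw [h2]
  refine h3.trans ?_
  rw [aeval_diagonal_ofReal]
  have h4 : (fun i => ((q.eval (l i) : ℝ) : ℂ)) = fun i => (f (l i) : ℂ) := by
    funext i
    rw [hev (l i) (by simp [hs])]
  rw [h4]
  simp [Unitary.conjStarAlgAut_apply, Matrix.star_eq_conjTranspose]

theorem spectral_decomposition {A : Matrix κ κ ℂ} (hA : A.IsHermitian) :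
    A = (hA.eigenvectorUnitary : Matrix κ κ ℂ) *
      Matrix.diagonal (fun i => (hA.eigenvalues i : ℂ)) *
        (hA.eigenvectorUnitary : Matrix κ κ ℂ)ᴴ := by
  have := hA.spectral_theorem
  rw [Unitary.conjStarAlgAut_apply] at this
  exact this

/-- The probability `⟨ψᵢ|ρ|ψᵢ⟩` of the `i`-th outcome of a measurement in the basis `U`. -/
noncomputable def bornProb (U : Matrix.unitaryGroup κ ℂ) (ρ : Matrix κ κ ℂ) (i : κ) : ℝ :=
  (((U : Matrix κ κ ℂ)ᴴ * ρ * (U : Matrix κ κ ℂ)) i i).re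

theorem trace_vecMulVec_mul {κ : Type*} [Fintype κ] (U : Matrix κ κ ℂ) (ρ : Matrix κ κ ℂ) (i : κ) :
    (Matrix.vecMulVec (fun k => U k i) (fun k => star (U k i)) * ρ).trace = (Uᴴ * ρ * U) i i := by
  simp only [Matrix.trace, Matrix.diag, Matrix.mul_apply, Matrix.vecMulVec_apply,
    Matrix.conjTranspose_apply, Finset.sum_mul]
  refine Finset.sum_congr rfl fun j _ => Finset.sum_congr rfl fun k _ => ?_
  ring

theorem Action.outcome_eq (a : Action κ) (ρ : Matrix κ κ ℂ) (i : κ) :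
    a.outcome ρ i = bornProb a.basis ρ i := by
  rw [Action.outcome, Action.proj, trace_vecMulVec_mul, bornProb]

theorem Action.trace_proj_mul (a : Action κ) {ρ : Matrix κ κ ℂ} (hρ : ρ.IsHermitian) (i : κ) :
    (a.proj i * ρ).trace = (a.outcome ρ i : ℂ) := by
  rw [a.outcome_eq, bornProb, Action.proj, trace_vecMulVec_mul]
  have h : ((a.basis : Matrix κ κ ℂ)ᴴ * ρ * (a.basis : Matrix κ κ ℂ)).IsHermitian :=
    Matrix.isHermitian_conjTranspose_mul_mul _ hρ
  exact (h.coe_re_apply_self i).symm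

theorem bornProb_nonneg (U : Matrix.unitaryGroup κ ℂ) {ρ : Matrix κ κ ℂ} (hρ : ρ.PosSemidef)
    (i : κ) : 0 ≤ bornProb U ρ i := by
  have h : ((U : Matrix κ κ ℂ)ᴴ * ρ * (U : Matrix κ κ ℂ)).PosSemidef :=
    hρ.conjTranspose_mul_mul_same _
  exact (Complex.le_def.1 (h.diag_nonneg (i := i))).1

theorem sum_bornProb (U : Matrix.unitaryGroup κ ℂ) (ρ : Matrix κ κ ℂ) :
    ∑ i, bornProb U ρ i = ρ.trace.re := by
  have h : ((U : Matrix κ κ ℂ)ᴴ * ρ * (U : Matrix κ κ ℂ)).trace = ρ.trace := by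
    rw [Matrix.trace_mul_comm, ← Matrix.mul_assoc, ← Matrix.star_eq_conjTranspose,
      Unitary.mul_star_self_of_mem U.2, Matrix.one_mul]
  rw [← h, Matrix.trace, Complex.re_sum]
  rfl

theorem bornProb_sum {α : Type*} (U : Matrix.unitaryGroup κ ℂ) (s : Finset α) (c : α → ℝ)
    (ρ : α → Matrix κ κ ℂ) (i : κ) :
    bornProb U (∑ x ∈ s, (c x : ℂ) • ρ x) i = ∑ x ∈ s, c x * bornProb U (ρ x) i := by
  simp [bornProb, Matrix.mul_sum, Matrix.sum_mul, Matrix.sum_apply]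

theorem continuous_bornProb (ρ : Matrix κ κ ℂ) (i : κ) :
    Continuous fun U : Matrix.unitaryGroup κ ℂ => bornProb U ρ i := by
  unfold bornProb
  have h : Continuous fun U : Matrix.unitaryGroup κ ℂ =>
      (U : Matrix κ κ ℂ)ᴴ * ρ * (U : Matrix κ κ ℂ) := by fun_prop
  exact Complex.continuous_re.comp (h.matrix_elem i i)

/-- Closed, with entries bounded by 1. This is why optimal bases exist and optimal values depend
continuously on the belief. -/
instance : CompactSpace (Matrix.unitaryGroup κ ℂ) := by
  have hc : IsClosed (Matrix.unitaryGroup κ ℂ : Set (Matrix κ κ ℂ)) := isClosed_unitary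
  have hb : IsCompact (Set.pi Set.univ fun _ : κ => Set.pi Set.univ fun _ : κ =>
      Metric.closedBall (0 : ℂ) 1) :=
    isCompact_univ_pi fun _ => isCompact_univ_pi fun _ => isCompact_closedBall _ _
  refine isCompact_iff_compactSpace.1 (?_ : IsCompact
    (Matrix.unitaryGroup κ ℂ : Set (Matrix κ κ ℂ)))
  refine hb.of_isClosed_subset hc ?_
  intro U hU i _ j _
  simpa using entry_norm_bound_of_unitary hU i j

end Spectral

/-! ### Relative entropy to a tailored state and Klein's inequality. -/

section Entropy

variable {κ : Type*} [Fintype κ] [DecidableEq κ]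

theorem matLog_state (a : Action κ) :
    matLog a.state = (a.basis : Matrix κ κ ℂ) *
      Matrix.diagonal (fun i => (Real.log (a.weight i) : ℂ)) * (a.basis : Matrix κ κ ℂ)ᴴ :=
  cfc_conj_diagonal _ _ _

/-- The negative von Neumann entropy `tr ρ ln ρ`. -/
noncomputable def negEntropy (ρ : Matrix κ κ ℂ) : ℝ := (ρ * matLog ρ).trace.re

theorem trace_mul_matLog_state (a : Action κ) (ρ : Matrix κ κ ℂ) :
    (ρ * matLog a.state).trace.re = ∑ i, a.outcome ρ i * Real.log (a.weight i) := by
  rw [matLog_state, ← Matrix.mul_assoc, Matrix.trace_mul_comm, ← Matrix.mul_assoc,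
    ← Matrix.mul_assoc, Matrix.trace, Complex.re_sum]
  refine Finset.sum_congr rfl fun i _ => ?_
  rw [a.outcome_eq, bornProb, Matrix.diag_apply, Matrix.mul_diagonal, Complex.re_mul_ofReal]

/-- The kernel of the tailored state is spanned by the basis vectors of weight zero, and for
positive semidefinite `ρ` a vanishing quadratic form at `ψ` forces `ρψ = 0`. Finiteness of the
relative entropy thus becomes a condition on outcome probabilities. -/
theorem support_condition_iff (a : Action κ) {ρ : Matrix κ κ ℂ} (hρ : ρ.PosSemidef) :
    (∀ v : κ → ℂ, a.state *ᵥ v = 0 → ρ *ᵥ v = 0) ↔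
      ∀ i, a.weight i = 0 → a.outcome ρ i = 0 := by
  set U := (a.basis : Matrix κ κ ℂ) with hU
  have hUU : Uᴴ * U = 1 := by
    rw [← Matrix.star_eq_conjTranspose]; exact Unitary.coe_star_mul_self a.basis
  have hUU' : U * Uᴴ = 1 := by
    rw [← Matrix.star_eq_conjTranspose]; exact Unitary.coe_mul_star_self a.basis
  constructor
  · intro h i hi
    have h1 : a.state *ᵥ (U *ᵥ Pi.single i 1) = 0 := by
      rw [Action.state, Matrix.mulVec_mulVec, Matrix.mul_assoc, ← hU, hUU, Matrix.mul_one,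
        ← Matrix.mulVec_mulVec]
      simp [hi]
    have h2 := h _ h1
    rw [a.outcome_eq, bornProb, ← hU]
    have h3 : (Uᴴ * ρ * U) *ᵥ Pi.single i 1 = 0 := by
      rw [← Matrix.mulVec_mulVec, ← Matrix.mulVec_mulVec, h2, Matrix.mulVec_zero]
    have h4 := congrFun h3 i
    simp only [Matrix.mulVec_single_one, Matrix.col_apply, Pi.zero_apply] at h4
    simp [h4]
  · intro h v hv
    have h1 : ∀ i, (a.weight i : ℂ) * (Uᴴ *ᵥ v) i = 0 := by
      intro i
      have h2 : Uᴴ *ᵥ (a.state *ᵥ v) = 0 := by rw [hv, Matrix.mulVec_zero]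
      rw [Action.state, Matrix.mulVec_mulVec, ← Matrix.mul_assoc, ← Matrix.mul_assoc, ← hU, hUU,
        Matrix.one_mul, ← Matrix.mulVec_mulVec] at h2
      simpa [Matrix.mulVec_diagonal] using congrFun h2 i
    have h2 : ρ *ᵥ v = (ρ * U) *ᵥ (Uᴴ *ᵥ v) := by
      rw [Matrix.mulVec_mulVec, Matrix.mul_assoc, hUU', Matrix.mul_one]
    rw [h2]
    funext k
    rw [Matrix.mulVec, dotProduct]
    refine Finset.sum_eq_zero fun i _ => ?_
    rcases mul_eq_zero.1 (h1 i) with h3 | h3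
    · have h4 := h i (by exact_mod_cast h3)
      have h5 : star (U *ᵥ Pi.single i 1) ⬝ᵥ (ρ *ᵥ (U *ᵥ Pi.single i 1)) = 0 := by
        have h6 := a.trace_proj_mul hρ.isHermitian i
        rw [h4, Action.proj, trace_vecMulVec_mul, ← hU] at h6
        rw [Matrix.star_mulVec, ← Matrix.dotProduct_mulVec, Matrix.mulVec_mulVec,
          Matrix.mulVec_mulVec]
        simpa [Pi.star_single] using h6
      rw [hρ.dotProduct_mulVec_zero_iff, Matrix.mulVec_mulVec] at h5
      have h6 := congrFun h5 k
      simp only [Matrix.mulVec_single_one, Matrix.col_apply, Pi.zero_apply] at h6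
      rw [h6, zero_mul]
    · rw [h3, mul_zero]

/-- The relative entropy with respect to a state in diagonal form. -/
theorem relEntropy_state (a : Action κ) {ρ : Matrix κ κ ℂ} (hρ : ρ.PosSemidef)
    (h : ∀ i, a.weight i = 0 → a.outcome ρ i = 0) :
    relEntropy ρ a.state =
      ((negEntropy ρ - ∑ i, a.outcome ρ i * Real.log (a.weight i) : ℝ) : EReal) := by
  rw [relEntropy, if_pos ((support_condition_iff a hρ).2 h), Matrix.mul_sub, Matrix.trace_sub,
    Complex.sub_re, trace_mul_matLog_state, negEntropy]

theorem relEntropy_state_eq_top (a : Action κ) {ρ : Matrix κ κ ℂ} (hρ : ρ.PosSemidef)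
    (h : ¬ ∀ i, a.weight i = 0 → a.outcome ρ i = 0) : relEntropy ρ a.state = ⊤ := by
  rw [relEntropy, if_neg (mt (support_condition_iff a hρ).1 h)]

/-- The ideal extraction protocol tailored to a given density matrix. -/
theorem exists_action_state_eq {ρ : Matrix κ κ ℂ} (hρ : IsDensity ρ) :
    ∃ a : Action κ, a.state = ρ ∧ ∀ i, a.outcome ρ i = a.weight i := by
  have hh := hρ.1.isHermitian
  have hs := spectral_decomposition hh
  have hUU : (hh.eigenvectorUnitary : Matrix κ κ ℂ)ᴴ *
      (hh.eigenvectorUnitary : Matrix κ κ ℂ) = 1 :=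
    Unitary.coe_star_mul_self hh.eigenvectorUnitary
  have hb : ∀ i, bornProb hh.eigenvectorUnitary ρ i = hh.eigenvalues i := by
    intro i
    rw [bornProb]
    have h1 : (hh.eigenvectorUnitary : Matrix κ κ ℂ)ᴴ * ρ *
        (hh.eigenvectorUnitary : Matrix κ κ ℂ) =
          Matrix.diagonal (fun i => (hh.eigenvalues i : ℂ)) := by
      calc _ = (hh.eigenvectorUnitary : Matrix κ κ ℂ)ᴴ * ((hh.eigenvectorUnitary : Matrix κ κ ℂ) *
            Matrix.diagonal (fun i => (hh.eigenvalues i : ℂ)) *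
              (hh.eigenvectorUnitary : Matrix κ κ ℂ)ᴴ) *
                (hh.eigenvectorUnitary : Matrix κ κ ℂ) := by rw [← hs]
        _ = _ := by
          rw [← Matrix.mul_assoc, ← Matrix.mul_assoc, hUU, Matrix.one_mul, Matrix.mul_assoc, hUU,
            Matrix.mul_one]
    rw [h1]
    simp
  refine ⟨⟨hh.eigenvectorUnitary, hh.eigenvalues, ?_, ?_⟩, hs.symm, fun i => ?_⟩
  · exact fun i => hρ.1.eigenvalues_nonneg i
  · rw [← Finset.sum_congr rfl fun i _ => hb i, sum_bornProb, hρ.2, Complex.one_re]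
  · rw [Action.outcome_eq]
    exact hb i

theorem negEntropy_eq_of_state {ρ : Matrix κ κ ℂ} {a : Action κ} (ha : a.state = ρ)
    (ho : ∀ i, a.outcome ρ i = a.weight i) :
    negEntropy ρ = ∑ i, a.weight i * Real.log (a.weight i) := by
  have := trace_mul_matLog_state a ρ
  rw [ha] at this
  rw [negEntropy, this]
  simp [ho]

theorem negEntropy_nonpos {ρ : Matrix κ κ ℂ} (hρ : IsDensity ρ) : negEntropy ρ ≤ 0 := by
  obtain ⟨a, ha, ho⟩ := exists_action_state_eq hρ
  rw [negEntropy_eq_of_state ha ho]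
  refine Finset.sum_nonpos fun i _ => ?_
  have h1 : a.weight i ≤ 1 := by
    rw [← a.weight_mem.2]
    exact Finset.single_le_sum (fun j _ => a.weight_mem.1 j) (Finset.mem_univ i)
  exact mul_nonpos_of_nonneg_of_nonpos (a.weight_mem.1 i)
    (Real.log_nonpos (a.weight_mem.1 i) h1)

/-- This is `log x ≤ x - 1` at `x = l / r`. The hypothesis `h` excludes `l = 0 < r`, where the
convention `log 0 = 0` would break the inequality. -/
theorem mul_log_le_mul_log_add {r l : ℝ} (hr : 0 ≤ r) (hl : 0 ≤ l) (h : l = 0 → r = 0) :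
    r * Real.log l ≤ r * Real.log r + (l - r) := by
  rcases hr.eq_or_lt with rfl | hr
  · simpa using hl
  have hl : 0 < l := lt_of_le_of_ne hl fun h' => hr.ne' (h h'.symm)
  have h1 := Real.log_le_sub_one_of_pos (div_pos hl hr)
  rw [Real.log_div hl.ne' hr.ne'] at h1
  have h2 := mul_le_mul_of_nonneg_left h1 hr.le
  have h3 : r * (l / r - 1) = l - r := by field_simp
  linarith

/-- Klein's inequality in the form of a bound on the mean logarithm of the weights of an
action. -/
theorem sum_outcome_mul_log_le {ρ : Matrix κ κ ℂ} (hρ : IsDensity ρ) (a : Action κ)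
    (h : ∀ i, a.weight i = 0 → a.outcome ρ i = 0) :
    ∑ i, a.outcome ρ i * Real.log (a.weight i) ≤ negEntropy ρ := by
  obtain ⟨b, hb, ho⟩ := exists_action_state_eq hρ
  rw [negEntropy_eq_of_state hb ho]
  -- Overlap matrix of the basis of `a` with an eigenbasis of `ρ`. Its squared moduli `B` form a
  -- doubly stochastic matrix that maps the eigenvalues of `ρ` to the outcome probabilities.
  set N : Matrix.unitaryGroup κ ℂ := star a.basis * b.basis with hN
  set B : κ → κ → ℝ := fun i k => Complex.normSq ((N : Matrix κ κ ℂ) i k) with hB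
  have hB0 : ∀ i k, 0 ≤ B i k := fun i k => Complex.normSq_nonneg _
  have hrow : ∀ i, ∑ k, B i k = 1 := by
    intro i
    have h1 := congrFun (congrFun (Unitary.coe_mul_star_self N) i) i
    rw [Matrix.mul_apply, Matrix.one_apply_eq] at h1
    have h2 := congrArg Complex.re h1
    rw [Complex.re_sum, Complex.one_re] at h2
    rw [← h2]
    refine Finset.sum_congr rfl fun k _ => ?_
    simp [hB, Matrix.star_apply, Complex.normSq_apply]
  have hcol : ∀ k, ∑ i, B i k = 1 := by
    intro k
    have h1 := congrFun (congrFun (Unitary.coe_star_mul_self N) k) k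
    rw [Matrix.mul_apply, Matrix.one_apply_eq] at h1
    have h2 := congrArg Complex.re h1
    rw [Complex.re_sum, Complex.one_re] at h2
    rw [← h2]
    refine Finset.sum_congr rfl fun i _ => ?_
    simp [hB, Matrix.star_apply, Complex.normSq_apply]
  have hout : ∀ i, a.outcome ρ i = ∑ k, B i k * b.weight k := by
    intro i
    rw [a.outcome_eq, bornProb, ← hb, Action.state]
    have h1 : (a.basis : Matrix κ κ ℂ)ᴴ * ((b.basis : Matrix κ κ ℂ) *
        Matrix.diagonal (fun i => (b.weight i : ℂ)) * (b.basis : Matrix κ κ ℂ)ᴴ) *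
          (a.basis : Matrix κ κ ℂ) = (N : Matrix κ κ ℂ) *
            Matrix.diagonal (fun i => (b.weight i : ℂ)) * (N : Matrix κ κ ℂ)ᴴ := by
      simp [hN, Matrix.star_eq_conjTranspose, Matrix.mul_assoc]
    rw [h1, Matrix.mul_apply, Complex.re_sum]
    refine Finset.sum_congr rfl fun k _ => ?_
    simp [hB, Matrix.mul_diagonal, Complex.normSq_apply]
    ring
  -- Klein's inequality termwise. The linear corrections cancel after summation, since `B` is doubly
  -- stochastic and both weight vectors sum to 1.
  have hterm : ∀ i k, B i k * (b.weight k * Real.log (a.weight i)) ≤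
      B i k * (b.weight k * Real.log (b.weight k) + (a.weight i - b.weight k)) := by
    intro i k
    rcases (hB0 i k).eq_or_lt with h0 | h0
    · simp [← h0]
    refine mul_le_mul_of_nonneg_left ?_ h0.le
    refine mul_log_le_mul_log_add (b.weight_mem.1 k) (a.weight_mem.1 i) fun hi => ?_
    have h1 := h i hi
    rw [hout, Finset.sum_eq_zero_iff_of_nonneg
      fun k _ => mul_nonneg (hB0 i k) (b.weight_mem.1 k)] at h1
    exact (mul_eq_zero.1 (h1 k (Finset.mem_univ k))).resolve_left h0.ne'
  calc ∑ i, a.outcome ρ i * Real.log (a.weight i)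
      = ∑ i, ∑ k, B i k * (b.weight k * Real.log (a.weight i)) := by
        refine Finset.sum_congr rfl fun i _ => ?_
        rw [hout, Finset.sum_mul]
        exact Finset.sum_congr rfl fun k _ => by ring
    _ ≤ ∑ i, ∑ k, B i k * (b.weight k * Real.log (b.weight k) + (a.weight i - b.weight k)) :=
        Finset.sum_le_sum fun i _ => Finset.sum_le_sum fun k _ => hterm i k
    _ = ∑ k, (∑ i, B i k) * (b.weight k * Real.log (b.weight k)) +
          (∑ i, (∑ k, B i k) * a.weight i - ∑ k, (∑ i, B i k) * b.weight k) := by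
        simp only [mul_add, mul_sub, Finset.sum_add_distrib, Finset.sum_sub_distrib,
          Finset.sum_mul]
        congr 1
        · exact Finset.sum_comm
        · congr 1
          exact Finset.sum_comm
    _ = ∑ k, b.weight k * Real.log (b.weight k) := by
        simp [hrow, hcol, a.weight_mem.2, b.weight_mem.2]

end Entropy

/-! ### The thermal state as a tailored state. -/

section Gibbs

variable {κ : Type*} [Fintype κ] [DecidableEq κ]

/-- The thermal state is the tailored state of an action with strictly positive weights. -/
theorem exists_action_state_eq_gibbs [Nonempty κ] (β : ℝ) {H : Matrix κ κ ℂ}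
    (hH : H.IsHermitian) :
    ∃ a : Action κ, a.state = gibbs β H ∧ ∀ i, 0 < a.weight i := by
  set U := hH.eigenvectorUnitary
  set e : κ → ℝ := fun i => Real.exp (-(β * hH.eigenvalues i)) with he
  have hbol : boltzmann β H = (U : Matrix κ κ ℂ) * Matrix.diagonal (fun i => (e i : ℂ)) *
      (U : Matrix κ κ ℂ)ᴴ := by
    rw [boltzmann]
    conv_lhs => rw [spectral_decomposition hH]
    rw [cfc_conj_diagonal]
  have hZ : partitionFunction β H = ∑ i, e i := by
    rw [partitionFunction, hbol, Matrix.trace_mul_comm, ← Matrix.mul_assoc,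
      ← Matrix.star_eq_conjTranspose, Unitary.coe_star_mul_self, Matrix.one_mul,
      Matrix.trace_diagonal, ← Complex.ofReal_sum, Complex.ofReal_re]
  have he0 : ∀ i, 0 < e i := fun i => Real.exp_pos _
  have hZ0 : 0 < ∑ i, e i := Finset.sum_pos (fun i _ => he0 i) Finset.univ_nonempty
  refine ⟨⟨U, fun i => (∑ j, e j)⁻¹ * e i, fun i => ?_, ?_⟩, ?_, fun i => ?_⟩
  · exact (mul_pos (inv_pos.2 hZ0) (he0 i)).le
  · rw [← Finset.mul_sum, inv_mul_cancel₀ hZ0.ne']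
  · rw [gibbs, hbol, hZ, Action.state]
    have h1 : (Matrix.diagonal fun i => (((∑ j, e j)⁻¹ * e i : ℝ) : ℂ)) =
        (((∑ j, e j)⁻¹ : ℝ) : ℂ) • Matrix.diagonal fun i => (e i : ℂ) := by
      ext i j
      by_cases hij : i = j <;> simp [hij, Matrix.diagonal]
    rw [h1]
    simp
  · exact mul_pos (inv_pos.2 hZ0) (he0 i)

end Gibbs

/-- The total mass of a vector of weights. -/
def mass {S : Type*} [Fintype S] : (S → ℝ) →ₗ[ℝ] ℝ where
  toFun v := v ⬝ᵥ 1
  map_add' u v := add_dotProduct u v 1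
  map_smul' c v := smul_dotProduct c v 1

theorem mass_apply {S : Type*} [Fintype S] (v : S → ℝ) : mass v = v ⬝ᵥ 1 := rfl

theorem mass_eq_sum {S : Type*} [Fintype S] (v : S → ℝ) : mass v = ∑ s, v s := dotProduct_one v

theorem mass_nonneg {S : Type*} [Fintype S] {v : S → ℝ} (hv : 0 ≤ v) : 0 ≤ mass v := by
  rw [mass_eq_sum]
  exact Finset.sum_nonneg fun s _ => hv s

theorem eq_zero_of_mass_eq_zero {S : Type*} [Fintype S] {v : S → ℝ} (hv : 0 ≤ v)
    (h : mass v = 0) : v = 0 := by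
  rw [mass_eq_sum, Finset.sum_eq_zero_iff_of_nonneg fun s _ => hv s] at h
  funext s
  exact h s (Finset.mem_univ s)

theorem mass_of_mem_stdSimplex {S : Type*} [Fintype S] {v : S → ℝ} (hv : v ∈ stdSimplex ℝ S) :
    mass v = 1 := by
  rw [mass_eq_sum]
  exact hv.2

theorem inv_mass_smul_mem_stdSimplex {S : Type*} [Fintype S] {v : S → ℝ} (hv : 0 ≤ v)
    (h : mass v ≠ 0) : (mass v)⁻¹ • v ∈ stdSimplex ℝ S := by
  refine ⟨fun s => mul_nonneg (inv_nonneg.2 (mass_nonneg hv)) (hv s), ?_⟩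
  have := mass_eq_sum ((mass v)⁻¹ • v)
  rw [map_smul, smul_eq_mul, inv_mul_cancel₀ h] at this
  exact this.symm

theorem continuous_mass {S : Type*} [Fintype S] : Continuous (mass : (S → ℝ) →ₗ[ℝ] ℝ) :=
  LinearMap.continuous_of_finiteDimensional _

/-- Gibbs' inequality for unnormalized weights. -/
theorem sum_mul_log_le {κ : Type*} [Fintype κ] {p l : κ → ℝ} (hp : 0 ≤ p)
    (hl : l ∈ stdSimplex ℝ κ) (h : ∀ i, l i = 0 → p i = 0) :
    ∑ i, p i * Real.log (l i) ≤ ∑ i, p i * Real.log (p i) - (∑ i, p i) * Real.log (∑ i, p i) := by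
  set P := ∑ i, p i with hP
  have hP0 : 0 ≤ P := Finset.sum_nonneg fun i _ => hp i
  rcases hP0.eq_or_lt with h0 | h0
  · have : ∀ i, p i = 0 := fun i =>
      (Finset.sum_eq_zero_iff_of_nonneg fun i _ => hp i).1 h0.symm i (Finset.mem_univ i)
    simp [this, ← h0]
  have hterm : ∀ i, p i * Real.log P + p i * Real.log (l i) ≤
      p i * Real.log (p i) + (P * l i - p i) := by
    intro i
    by_cases hi : l i = 0
    · simp [hi, h i hi]
    · have := mul_log_le_mul_log_add (hp i) (mul_nonneg h0.le (hl.1 i))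
        fun h' => absurd h' (mul_ne_zero h0.ne' hi)
      rwa [Real.log_mul h0.ne' hi, mul_add] at this
  have hsum := Finset.sum_le_sum fun i (_ : i ∈ Finset.univ) => hterm i
  rw [Finset.sum_add_distrib, Finset.sum_add_distrib, Finset.sum_sub_distrib, ← Finset.sum_mul,
    ← Finset.mul_sum, hl.2, ← hP] at hsum
  linarith

theorem EReal.coe_finset_sum {α : Type*} (s : Finset α) (f : α → ℝ) :
    ((∑ i ∈ s, f i : ℝ) : EReal) = ∑ i ∈ s, (f i : EReal) := by
  classical
  induction s using Finset.induction_on with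
  | empty => simp
  | insert a s ha ih => rw [Finset.sum_insert ha, Finset.sum_insert ha, EReal.coe_add, ih]

/-! ### Unnormalized beliefs and the homogeneous value function. -/

namespace QuantumHMM

variable {S X ι : Type*} [Fintype S] [DecidableEq S] [Fintype X] [Fintype ι] [DecidableEq ι]
  (Q : QuantumHMM S X ι)

/-- The unnormalized Bayesian update after outcome `i` of a measurement in the basis `U`. -/
noncomputable def branch (U : Matrix.unitaryGroup ι ℂ) (i : ι) : (S → ℝ) →ₗ[ℝ] (S → ℝ) :=
  ∑ x, bornProb U (Q.emit x) i • (Q.trans x).vecMulLinear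

theorem branch_apply (U : Matrix.unitaryGroup ι ℂ) (i : ι) (v : S → ℝ) :
    Q.branch U i v = ∑ x, bornProb U (Q.emit x) i • (v ᵥ* Q.trans x) := by
  simp [branch, LinearMap.sum_apply]

/-- The normalization lost in a branch is exactly the probability of its outcome, so masses carry
probabilities along a history. -/
theorem mass_branch (U : Matrix.unitaryGroup ι ℂ) (i : ι) (v : S → ℝ) :
    mass (Q.branch U i v) = bornProb U (Q.expectedState v) i := by
  rw [expectedState, bornProb_sum, branch_apply, map_sum]
  refine Finset.sum_congr rfl fun x _ => ?_
  rw [map_smul, smul_eq_mul, mul_comm, mass_apply, symbolProb]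

theorem sum_branch (U : Matrix.unitaryGroup ι ℂ) (v : S → ℝ) :
    ∑ i, Q.branch U i v = v ᵥ* ∑ x, Q.trans x := by
  simp_rw [branch_apply]
  rw [Finset.sum_comm, Matrix.vecMul_sum]
  refine Finset.sum_congr rfl fun x _ => ?_
  rw [← Finset.sum_smul, sum_bornProb, (Q.emit_density x).2, Complex.one_re, one_smul]

theorem mass_vecMul_sum (v : S → ℝ) : mass (v ᵥ* ∑ x, Q.trans x) = mass v := by
  rw [mass_apply, ← Matrix.dotProduct_mulVec, mass_apply]
  congr 1
  funext s
  have := Q.trans_sum s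
  rw [Finset.sum_comm] at this
  simp only [Matrix.mulVec, dotProduct_one, Matrix.sum_apply, Pi.one_apply]
  exact this

theorem sum_mass_branch (U : Matrix.unitaryGroup ι ℂ) (v : S → ℝ) :
    ∑ i, mass (Q.branch U i v) = mass v := by
  rw [← map_sum, sum_branch, mass_vecMul_sum]

theorem vecMul_trans_nonneg {v : S → ℝ} (hv : 0 ≤ v) (x : X) : 0 ≤ v ᵥ* Q.trans x :=
  fun s => Finset.sum_nonneg fun r _ => mul_nonneg (hv r) (Q.trans_nonneg x r s)

theorem branch_nonneg (U : Matrix.unitaryGroup ι ℂ) (i : ι) {v : S → ℝ} (hv : 0 ≤ v) :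
    0 ≤ Q.branch U i v := by
  rw [branch_apply]
  exact Finset.sum_nonneg fun x _ =>
    smul_nonneg (bornProb_nonneg U (Q.emit_density x).1 i) (Q.vecMul_trans_nonneg hv x)

theorem continuous_branch (i : ι) :
    Continuous fun p : (S → ℝ) × Matrix.unitaryGroup ι ℂ => Q.branch p.2 i p.1 := by
  simp_rw [branch_apply]
  refine continuous_finsetSum _ fun x _ => ?_
  refine ((continuous_bornProb (Q.emit x) i).comp continuous_snd).smul ?_
  exact continuous_fst.matrix_vecMul continuous_const

/-- The mean energy `-tr ξ ln γ` of the expected state, where `γ` is the tailored state of the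
action `G`. -/
noncomputable def energy (G : Action ι) : (S → ℝ) →ₗ[ℝ] ℝ :=
  -∑ i, Real.log (G.weight i) • (mass ∘ₗ Q.branch G.basis i)

theorem energy_apply (G : Action ι) (v : S → ℝ) :
    Q.energy G v = -∑ i, mass (Q.branch G.basis i v) * Real.log (G.weight i) := by
  simp [energy, LinearMap.sum_apply, mul_comm]

/-- The expected work in the best action with eigenbasis `U`, extended to a positively homogeneous
function of the belief state. -/
noncomputable def gain (β : ℝ) (G : Action ι) (U : Matrix.unitaryGroup ι ℂ) (v : S → ℝ) : ℝ :=
  β⁻¹ * (Q.energy G v + (∑ i, mass (Q.branch U i v) * Real.log (mass (Q.branch U i v)) -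
    mass v * Real.log (mass v)))

/-- The optimal expected work in `n` steps, extended to a positively homogeneous function of the
belief state. -/
noncomputable def value (β : ℝ) (G : Action ι) : ℕ → (S → ℝ) → ℝ
  | 0, _ => 0
  | n + 1, v => ⨆ U : Matrix.unitaryGroup ι ℂ,
      (Q.gain β G U v + ∑ i, value β G n (Q.branch U i v))

variable {β : ℝ} {G : Action ι}

theorem continuous_gain :
    Continuous fun p : (S → ℝ) × Matrix.unitaryGroup ι ℂ => Q.gain β G p.2 p.1 := by
  unfold gain
  have hE : Continuous (Q.energy G) := LinearMap.continuous_of_finiteDimensional _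
  refine continuous_const.mul ((hE.comp continuous_fst).add (.sub ?_ ?_))
  · exact continuous_finsetSum _ fun i _ =>
      Real.continuous_mul_log.comp (continuous_mass.comp (Q.continuous_branch i))
  · exact Real.continuous_mul_log.comp (continuous_mass.comp continuous_fst)

theorem continuous_objective {n : ℕ} (h : Continuous (Q.value β G n)) :
    Continuous fun p : (S → ℝ) × Matrix.unitaryGroup ι ℂ =>
      Q.gain β G p.2 p.1 + ∑ i, Q.value β G n (Q.branch p.2 i p.1) :=
  Q.continuous_gain.add (continuous_finsetSum _ fun i _ => h.comp (Q.continuous_branch i))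

/-- A maximum over a compact set of a jointly continuous function is continuous. -/
theorem continuous_value (n : ℕ) : Continuous (Q.value β G n) := by
  induction n with
  | zero => exact continuous_const
  | succ n ih =>
    have h := (isCompact_univ (X := Matrix.unitaryGroup ι ℂ)).continuous_sSup
      (f := fun v U => Q.gain β G U v + ∑ i, Q.value β G n (Q.branch U i v))
      (Q.continuous_objective ih)
    simp only [Set.image_univ] at h
    exact h

theorem objective_le_value (n : ℕ) (U : Matrix.unitaryGroup ι ℂ) (v : S → ℝ) :
    Q.gain β G U v + ∑ i, Q.value β G n (Q.branch U i v) ≤ Q.value β G (n + 1) v := by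
  refine le_ciSup (f := fun U => Q.gain β G U v + ∑ i, Q.value β G n (Q.branch U i v)) ?_ U
  have h : Continuous fun U => Q.gain β G U v + ∑ i, Q.value β G n (Q.branch U i v) :=
    (Q.continuous_objective (Q.continuous_value n)).comp (Continuous.prodMk_right v)
  exact (isCompact_range h).bddAbove

theorem exists_objective_eq_value (n : ℕ) (v : S → ℝ) : ∃ U : Matrix.unitaryGroup ι ℂ,
    Q.gain β G U v + ∑ i, Q.value β G n (Q.branch U i v) = Q.value β G (n + 1) v := by
  have h : Continuous fun U => Q.gain β G U v + ∑ i, Q.value β G n (Q.branch U i v) :=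
    (Q.continuous_objective (Q.continuous_value n)).comp (Continuous.prodMk_right v)
  obtain ⟨U, hU⟩ := (isCompact_range h).sSup_mem (Set.range_nonempty _)
  exact ⟨U, hU⟩

/-- The defect from homogeneity is linear in `p`. In `gain` these defects cancel, because the masses
of the branches add up to the mass of the vector. -/
theorem mul_log_smul {c : ℝ} (hc : 0 ≤ c) (p : ℝ) :
    (c * p) * Real.log (c * p) = c * (p * Real.log p) + c * Real.log c * p := by
  rcases hc.eq_or_lt with rfl | hc
  · simp
  rcases eq_or_ne p 0 with rfl | hp
  · simp
  rw [Real.log_mul hc.ne' hp]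
  ring

theorem gain_smul (U : Matrix.unitaryGroup ι ℂ) {c : ℝ} (hc : 0 ≤ c) (v : S → ℝ) :
    Q.gain β G U (c • v) = c * Q.gain β G U v := by
  simp only [gain, map_smul, smul_eq_mul, mul_log_smul hc, Finset.sum_add_distrib,
    ← Finset.mul_sum, sum_mass_branch]
  ring

theorem value_smul (n : ℕ) {c : ℝ} (hc : 0 ≤ c) (v : S → ℝ) :
    Q.value β G n (c • v) = c * Q.value β G n v := by
  induction n generalizing v with
  | zero => simp [value]
  | succ n ih =>
    simp only [value, gain_smul Q _ hc, map_smul, ih, ← Finset.mul_sum, ← mul_add]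
    exact (Real.mul_iSup_of_nonneg hc _).symm

theorem value_zero (n : ℕ) : Q.value β G n 0 = 0 := by
  simpa using Q.value_smul (β := β) (G := G) n le_rfl 0

/-- Weights tuned to `u + v` are admissible but suboptimal for `u` and for `v` separately, by Gibbs'
inequality; the energy is linear. Together with homogeneity this is convexity of the gain in the
belief. -/
theorem gain_add_le (hβ : 0 < β) (U : Matrix.unitaryGroup ι ℂ) {u v : S → ℝ} (hu : 0 ≤ u)
    (hv : 0 ≤ v) : Q.gain β G U (u + v) ≤ Q.gain β G U u + Q.gain β G U v := by
  have huv : 0 ≤ u + v := add_nonneg hu hv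
  have hm : ∀ {w : S → ℝ}, 0 ≤ w → ∀ i, 0 ≤ mass (Q.branch U i w) := fun hw i =>
    mass_nonneg (Q.branch_nonneg U i hw)
  rcases (mass_nonneg huv).eq_or_lt with h0 | h0
  · have h1 := eq_zero_of_mass_eq_zero huv h0.symm
    have h2 : u = 0 := le_antisymm (by rw [← h1]; exact le_add_of_nonneg_right hv) hu
    have h3 : v = 0 := by rw [h2, zero_add] at h1; exact h1
    simp [h2, h3, gain]
  -- The outcome probabilities in the normalized belief `u + v`, used as common weights for both
  -- summands.
  set l : ι → ℝ := fun i => (mass (u + v))⁻¹ * mass (Q.branch U i (u + v)) with hl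
  have hl1 : l ∈ stdSimplex ℝ ι := by
    refine ⟨fun i => mul_nonneg (inv_nonneg.2 h0.le) (hm huv i), ?_⟩
    rw [← Finset.mul_sum, sum_mass_branch, inv_mul_cancel₀ h0.ne']
  have hl0 : ∀ i, l i = 0 → mass (Q.branch U i u) = 0 ∧ mass (Q.branch U i v) = 0 := by
    intro i hi
    have h1 := (mul_eq_zero.1 hi).resolve_left (inv_ne_zero h0.ne')
    rw [map_add, map_add] at h1
    exact (add_eq_zero_iff_of_nonneg (hm hu i) (hm hv i)).1 h1
  have hU := sum_mul_log_le (hm hu) hl1 fun i hi => (hl0 i hi).1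
  have hV := sum_mul_log_le (hm hv) hl1 fun i hi => (hl0 i hi).2
  rw [sum_mass_branch] at hU hV
  have hUV : ∑ i, mass (Q.branch U i (u + v)) * Real.log (mass (Q.branch U i (u + v))) -
      mass (u + v) * Real.log (mass (u + v)) =
        ∑ i, mass (Q.branch U i (u + v)) * Real.log (l i) := by
    rw [← Q.sum_mass_branch U (u + v), Finset.sum_mul, Q.sum_mass_branch U (u + v),
      ← Finset.sum_sub_distrib]
    refine Finset.sum_congr rfl fun i _ => ?_
    rcases eq_or_ne (mass (Q.branch U i (u + v))) 0 with h | h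
    · simp only [h, zero_mul, sub_zero]
    · rw [hl, Real.log_mul (inv_ne_zero h0.ne') h, Real.log_inv]
      ring
  rw [gain, hUV, gain, gain, ← mul_add]
  refine mul_le_mul_of_nonneg_left ?_ (inv_nonneg.2 hβ.le)
  simp only [map_add, add_mul, Finset.sum_add_distrib]
  linarith

/-- The optimal basis for `u + v` may be used for both summands, and branches are linear. An agent
that knows which component holds does at least as well. -/
theorem value_add_le (hβ : 0 < β) (n : ℕ) {u v : S → ℝ} (hu : 0 ≤ u) (hv : 0 ≤ v) :
    Q.value β G n (u + v) ≤ Q.value β G n u + Q.value β G n v := by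
  induction n generalizing u v with
  | zero => simp [value]
  | succ n ih =>
    obtain ⟨U, hU⟩ := Q.exists_objective_eq_value (β := β) (G := G) n (u + v)
    have h1 := Q.objective_le_value (β := β) (G := G) n U u
    have h2 := Q.objective_le_value (β := β) (G := G) n U v
    have h3 := Q.gain_add_le (G := G) hβ U hu hv
    have h4 : ∑ i, Q.value β G n (Q.branch U i (u + v)) ≤
        ∑ i, Q.value β G n (Q.branch U i u) + ∑ i, Q.value β G n (Q.branch U i v) := by
      rw [← Finset.sum_add_distrib]
      refine Finset.sum_le_sum fun i _ => ?_
      rw [map_add]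
      exact ih (Q.branch_nonneg U i hu) (Q.branch_nonneg U i hv)
    linarith

theorem value_sum_le (hβ : 0 < β) (n : ℕ) {α : Type*} (s : Finset α) (u : α → S → ℝ)
    (hu : ∀ o, 0 ≤ u o) : Q.value β G n (∑ o ∈ s, u o) ≤ ∑ o ∈ s, Q.value β G n (u o) := by
  classical
  induction s using Finset.induction_on with
  | empty => simp [value_zero]
  | insert a s ha ih =>
    rw [Finset.sum_insert ha, Finset.sum_insert ha]
    exact (Q.value_add_le hβ n (hu a) (Finset.sum_nonneg fun o _ => hu o)).trans (by gcongr)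

/-- One step yields at worst a bounded loss. -/
theorem exists_gain_ge : ∃ C : ℝ, 0 ≤ C ∧ ∀ (U : Matrix.unitaryGroup ι ℂ) (v : S → ℝ), 0 ≤ v →
    -C * mass v ≤ Q.gain β G U v := by
  -- A continuous function is bounded below on beliefs times bases; homogeneity extends the bound to
  -- all nonnegative vectors.
  have hK : IsCompact (stdSimplex ℝ S ×ˢ (Set.univ : Set (Matrix.unitaryGroup ι ℂ))) :=
    (isCompact_stdSimplex ℝ S).prod isCompact_univ
  obtain ⟨C, hC⟩ := (hK.image (Q.continuous_gain (β := β) (G := G))).bddBelow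
  refine ⟨|C|, abs_nonneg C, fun U v hv => ?_⟩
  rcases eq_or_ne (mass v) 0 with h0 | h0
  · rw [eq_zero_of_mass_eq_zero hv h0]
    simp [gain]
  have h1 := hC ⟨((mass v)⁻¹ • v, U), ⟨inv_mass_smul_mem_stdSimplex hv h0, trivial⟩, rfl⟩
  simp only [gain_smul Q U (inv_nonneg.2 (mass_nonneg hv))] at h1
  have h2 := mul_le_mul_of_nonneg_right h1 (mass_nonneg hv)
  have h3 : (mass v)⁻¹ * Q.gain β G U v * mass v = Q.gain β G U v := by field_simp
  rw [h3] at h2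
  refine le_trans ?_ h2
  exact mul_le_mul_of_nonneg_right (neg_abs_le C) (mass_nonneg hv)

/-! ### Rewards and dynamic programming -/

theorem expectedState_posSemidef {η : S → ℝ} (hη : 0 ≤ η) : (Q.expectedState η).PosSemidef := by
  rw [expectedState]
  refine Matrix.posSemidef_sum _ fun x _ => (Q.emit_density x).1.smul ?_
  exact_mod_cast mass_nonneg (Q.vecMul_trans_nonneg hη x)

theorem outcome_expectedState (a : Action ι) (η : S → ℝ) (i : ι) :
    a.outcome (Q.expectedState η) i = mass (Q.branch a.basis i η) := by
  rw [mass_branch, a.outcome_eq]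

theorem relEntropy_gibbs {H : Matrix ι ι ℂ} (hG : G.state = gibbs β H) (hG0 : ∀ i, 0 < G.weight i)
    {η : S → ℝ} (hη : 0 ≤ η) : relEntropy (Q.expectedState η) (gibbs β H) =
      ((negEntropy (Q.expectedState η) + Q.energy G η : ℝ) : EReal) := by
  rw [← hG, relEntropy_state _ (Q.expectedState_posSemidef hη)
    fun i hi => absurd hi (hG0 i).ne', energy_apply, sub_eq_add_neg]
  simp_rw [outcome_expectedState]

/-- The entropy of the expected state occurs in both relative entropies and cancels, so the reward
depends on it only through outcome probabilities. -/
theorem reward_eq {H : Matrix ι ι ℂ} (hG : G.state = gibbs β H) (hG0 : ∀ i, 0 < G.weight i)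
    {η : S → ℝ} (hη : 0 ≤ η) (a : Action ι)
    (h : ∀ i, a.weight i = 0 → mass (Q.branch a.basis i η) = 0) :
    Q.reward β H η a = ((β⁻¹ * (Q.energy G η +
      ∑ i, mass (Q.branch a.basis i η) * Real.log (a.weight i)) : ℝ) : EReal) := by
  rw [reward, dissipation, Q.relEntropy_gibbs hG hG0 hη,
    relEntropy_state _ (Q.expectedState_posSemidef hη) (by simpa [outcome_expectedState] using h),
    ← EReal.coe_sub, ← EReal.coe_mul]
  simp_rw [outcome_expectedState]
  congr 2
  ring

theorem reward_eq_bot (hβ : 0 < β) {H : Matrix ι ι ℂ} (hG : G.state = gibbs β H)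
    (hG0 : ∀ i, 0 < G.weight i) {η : S → ℝ} (hη : 0 ≤ η) (a : Action ι)
    (h : ¬ ∀ i, a.weight i = 0 → mass (Q.branch a.basis i η) = 0) :
    Q.reward β H η a = ⊥ := by
  rw [reward, dissipation, Q.relEntropy_gibbs hG hG0 hη,
    relEntropy_state_eq_top _ (Q.expectedState_posSemidef hη)
      (by simpa [outcome_expectedState] using h), EReal.sub_top,
    EReal.coe_mul_bot_of_pos (inv_pos.2 hβ)]

/-- Gibbs' inequality: in a given basis, the expected outcome probabilities are the best weights.
`reward_tunedAction` shows that the bound is attained. -/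
theorem reward_le_gain (hβ : 0 < β) {H : Matrix ι ι ℂ} (hG : G.state = gibbs β H)
    (hG0 : ∀ i, 0 < G.weight i) {η : S → ℝ} (hη : η ∈ stdSimplex ℝ S) (a : Action ι) :
    Q.reward β H η a ≤ (Q.gain β G a.basis η : EReal) := by
  by_cases h : ∀ i, a.weight i = 0 → mass (Q.branch a.basis i η) = 0
  · rw [Q.reward_eq hG hG0 hη.1 a h, EReal.coe_le_coe_iff, gain]
    have := sum_mul_log_le (fun i => mass_nonneg (Q.branch_nonneg a.basis i hη.1))
      a.weight_mem h
    rw [sum_mass_branch] at this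
    exact mul_le_mul_of_nonneg_left (by linarith) (inv_nonneg.2 hβ.le)
  · rw [Q.reward_eq_bot hβ hG hG0 hη.1 a h]
    exact bot_le

/-- The action with eigenbasis `U` and the expected outcome probabilities as weights. -/
noncomputable def tunedAction (U : Matrix.unitaryGroup ι ℂ) {η : S → ℝ}
    (hη : η ∈ stdSimplex ℝ S) : Action ι where
  basis := U
  weight i := mass (Q.branch U i η)
  weight_mem := ⟨fun i => mass_nonneg (Q.branch_nonneg U i hη.1), by
    rw [sum_mass_branch, mass_of_mem_stdSimplex hη]⟩

theorem reward_tunedAction {H : Matrix ι ι ℂ} (hG : G.state = gibbs β H)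
    (hG0 : ∀ i, 0 < G.weight i) {η : S → ℝ} (hη : η ∈ stdSimplex ℝ S)
    (U : Matrix.unitaryGroup ι ℂ) :
    Q.reward β H η (Q.tunedAction U hη) = (Q.gain β G U η : EReal) := by
  rw [Q.reward_eq hG hG0 hη.1 _ fun i hi => hi, gain, mass_of_mem_stdSimplex hη]
  simp [tunedAction]

theorem update_eq (η : S → ℝ) (a : Action ι) (i : ι) :
    Q.update η a i = (mass (Q.branch a.basis i η))⁻¹ • Q.branch a.basis i η := by
  rw [update, mass_branch, expectedState, bornProb_sum, branch_apply]
  simp_rw [a.outcome_eq, mul_comm]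

/-- Homogeneity absorbs the outcome probability into the belief. For an impossible outcome the
updated vector is not a belief state, but its value is multiplied by zero. -/
theorem outcome_mul_value {η : S → ℝ} (hη : 0 ≤ η) {V : (S → ℝ) → EReal} {n : ℕ}
    (hV : ∀ η ∈ stdSimplex ℝ S, V η = (Q.value β G n η : EReal)) (a : Action ι) (i : ι) :
    (a.outcome (Q.expectedState η) i : EReal) * V (Q.update η a i) =
      (Q.value β G n (Q.branch a.basis i η) : EReal) := by
  have hb := Q.branch_nonneg a.basis i hη
  rw [outcome_expectedState, update_eq]
  rcases eq_or_ne (mass (Q.branch a.basis i η)) 0 with h0 | h0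
  · rw [eq_zero_of_mass_eq_zero hb h0, value_zero]
    simp
  · rw [hV _ (inv_mass_smul_mem_stdSimplex hb h0), ← EReal.coe_mul,
      value_smul Q n (inv_nonneg.2 (mass_nonneg hb)), mul_inv_cancel_left₀ h0]

theorem objective_eq_of_eq {H : Matrix ι ι ℂ} {η : S → ℝ} (hη : 0 ≤ η) {V : (S → ℝ) → EReal}
    {n : ℕ} (hV : ∀ η ∈ stdSimplex ℝ S, V η = (Q.value β G n η : EReal)) (a : Action ι) :
    Q.objective β H V η a =
      Q.reward β H η a + ((∑ i, Q.value β G n (Q.branch a.basis i η) : ℝ) : EReal) := by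
  rw [objective, EReal.coe_finset_sum]
  congr 1
  exact Finset.sum_congr rfl fun i _ => Q.outcome_mul_value hη hV a i

/-- On belief states, the value computed by backward induction is a real number. -/
theorem dpValue_eq_value (hβ : 0 < β) {H : Matrix ι ι ℂ} (hG : G.state = gibbs β H)
    (hG0 : ∀ i, 0 < G.weight i) (n : ℕ) :
    ∀ η ∈ stdSimplex ℝ S, Q.dpValue β H n η = (Q.value β G n η : EReal) := by
  induction n with
  | zero => intro η _; simp [dpValue, value]
  | succ n ih =>
    intro η hη
    rw [dpValue]
    apply le_antisymm
    · refine iSup_le fun a => ?_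
      rw [Q.objective_eq_of_eq hη.1 ih]
      refine (add_le_add_left (Q.reward_le_gain hβ hG hG0 hη a) _).trans ?_
      rw [← EReal.coe_add]
      exact EReal.coe_le_coe_iff.2 (Q.objective_le_value n a.basis η)
    · obtain ⟨U, hU⟩ := Q.exists_objective_eq_value (β := β) (G := G) n η
      refine le_iSup_of_le (Q.tunedAction U hη) ?_
      rw [Q.objective_eq_of_eq hη.1 ih, Q.reward_tunedAction hG hG0, ← EReal.coe_add, ← hU]
      rfl

theorem objective_eq (hβ : 0 < β) {H : Matrix ι ι ℂ} (hG : G.state = gibbs β H)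
    (hG0 : ∀ i, 0 < G.weight i) (n : ℕ) {η : S → ℝ} (hη : η ∈ stdSimplex ℝ S) (a : Action ι) :
    Q.objective β H (Q.dpValue β H n) η a =
      Q.reward β H η a + ((∑ i, Q.value β G n (Q.branch a.basis i η) : ℝ) : EReal) :=
  Q.objective_eq_of_eq hη.1 (Q.dpValue_eq_value hβ hG hG0 n) a

theorem nonempty_action (Q : QuantumHMM S X ι) : Nonempty (Action ι) :=
  ⟨Q.tunedAction 1 Q.init_mem⟩

end QuantumHMM

theorem sum_fin_succ_fun {α M : Type*} [Fintype α] [AddCommMonoid M] {t : ℕ}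
    (F : (Fin (t + 1) → α) → M) : ∑ o, F o = ∑ o : Fin t → α, ∑ i, F (Fin.snoc o i) := by
  rw [← Fintype.sum_equiv (Fin.snocEquiv fun _ => α) (fun p => F (Fin.snoc p.2 p.1)) F
    fun p => rfl, Fintype.sum_prod_type_right]

theorem trace_tensor_mul {ι : Type*} [Fintype ι] {T : ℕ} (A B : Fin T → Matrix ι ι ℂ) :
    (tensor A * tensor B).trace = ∏ t, (A t * B t).trace := by
  simp only [Matrix.trace, Matrix.diag, Matrix.mul_apply, tensor, Matrix.of_apply,
    ← Finset.prod_mul_distrib]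
  rw [Fintype.prod_sum]
  refine Finset.sum_congr rfl fun i _ => ?_
  rw [Fintype.prod_sum]

/-! ### Outcome histories, optimality and the Bellman recursion. -/

namespace QuantumHMM

variable {S X ι : Type*} [Fintype S] [DecidableEq S] [Fintype X] [Fintype ι] [DecidableEq ι]
  (Q : QuantumHMM S X ι)

/-- The belief state after the outcomes `o`, multiplied by the probability of `o`. -/
noncomputable def weightedBelief (Λ : Policy S ι) : (t : ℕ) → (Fin t → ι) → S → ℝ
  | 0, _ => Q.init
  | t + 1, o => Q.branch (Λ t (Q.belief Λ t (Fin.init o))).basis (o (Fin.last t))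
      (weightedBelief Λ t (Fin.init o))

variable (Λ : Policy S ι)

theorem weightedBelief_snoc {t : ℕ} (o : Fin t → ι) (i : ι) :
    Q.weightedBelief Λ (t + 1) (Fin.snoc o i) =
      Q.branch (Λ t (Q.belief Λ t o)).basis i (Q.weightedBelief Λ t o) := by
  simp [weightedBelief]

theorem weightedBelief_nonneg {t : ℕ} (o : Fin t → ι) : 0 ≤ Q.weightedBelief Λ t o := by
  induction t with
  | zero => exact Q.init_mem.1
  | succ t ih => exact Q.branch_nonneg _ _ (ih _)

/-- Branches are linear, so the successive Bayesian normalizations combine into one. With `0⁻¹ = 0`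
both sides vanish on impossible histories of positive length. -/
theorem belief_eq {t : ℕ} (o : Fin t → ι) :
    Q.belief Λ t o = (mass (Q.weightedBelief Λ t o))⁻¹ • Q.weightedBelief Λ t o := by
  induction t with
  | zero => simp [belief, weightedBelief, mass_of_mem_stdSimplex Q.init_mem]
  | succ t ih =>
    rw [belief, update_eq, weightedBelief]
    set b := Q.belief Λ t (Fin.init o)
    set w := Q.weightedBelief Λ t (Fin.init o) with hw
    have hb : b = (mass w)⁻¹ • w := ih _
    rcases eq_or_ne (mass w) 0 with h0 | h0
    · have hw0 : w = 0 := eq_zero_of_mass_eq_zero (Q.weightedBelief_nonneg Λ _) h0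
      have hb0 : b = 0 := by rw [hb, hw0, smul_zero]
      rw [hw0]
      nth_rw 2 [hb0]
      simp
    · nth_rw 2 4 [hb]
      rw [map_smul, map_smul, smul_smul, smul_eq_mul, mul_inv, inv_inv, mul_comm (mass w),
        mul_assoc, mul_inv_cancel₀ h0, mul_one]

theorem weightedBelief_eq {t : ℕ} (o : Fin t → ι) :
    Q.weightedBelief Λ t o = mass (Q.weightedBelief Λ t o) • Q.belief Λ t o := by
  rw [belief_eq]
  rcases eq_or_ne (mass (Q.weightedBelief Λ t o)) 0 with h0 | h0
  · rw [eq_zero_of_mass_eq_zero (Q.weightedBelief_nonneg Λ o) h0]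
    simp
  · rw [smul_inv_smul₀ h0]

theorem belief_mem_stdSimplex {t : ℕ} {o : Fin t → ι} (h : mass (Q.weightedBelief Λ t o) ≠ 0) :
    Q.belief Λ t o ∈ stdSimplex ℝ S := by
  rw [belief_eq]
  exact inv_mass_smul_mem_stdSimplex (Q.weightedBelief_nonneg Λ o) h

theorem sum_weightedBelief (t : ℕ) :
    ∑ o, Q.weightedBelief Λ t o = Q.init ᵥ* (∑ x, Q.trans x) ^ t := by
  induction t with
  | zero => simp [weightedBelief]
  | succ t ih =>
    rw [sum_fin_succ_fun]
    simp_rw [weightedBelief_snoc, sum_branch]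
    rw [← Matrix.sum_vecMul, ih, Matrix.vecMul_vecMul, pow_succ]

theorem sum_mass_weightedBelief (t : ℕ) : ∑ o, mass (Q.weightedBelief Λ t o) = 1 := by
  induction t with
  | zero => simp [weightedBelief, mass_of_mem_stdSimplex Q.init_mem]
  | succ t ih =>
    rw [sum_fin_succ_fun]
    simp_rw [weightedBelief_snoc, sum_mass_branch]
    exact ih

/-- Bridge between the physical description, a sum over emitted words, and the recursive filter:
expanding every branch over its symbol yields the product of transition matrices. -/
theorem sum_prod_bornProb_smul {t : ℕ} (o : Fin t → ι) :
    ∑ x : Fin t → X, (∏ s, bornProb (Q.actionAt Λ o s).basis (Q.emit (x s)) (o s)) •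
      (Q.init ᵥ* (List.ofFn fun s => Q.trans (x s)).prod) = Q.weightedBelief Λ t o := by
  induction t with
  | zero => simp [weightedBelief]
  | succ t ih =>
    rw [sum_fin_succ_fun, weightedBelief, ← ih, map_sum]
    refine Finset.sum_congr rfl fun x _ => ?_
    rw [map_smul, branch_apply, Finset.smul_sum]
    refine Finset.sum_congr rfl fun y _ => ?_
    rw [smul_smul, Fin.prod_univ_castSucc, List.ofFn_succ', List.concat_eq_append,
      List.prod_append, List.prod_singleton, ← Matrix.vecMul_vecMul]
    simp only [Fin.snoc_castSucc, Fin.snoc_last]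
    rfl

theorem trace_tensor_proj_mul_multiTimeState {t : ℕ} (a : Fin t → Action ι) (o : Fin t → ι) :
    ((tensor fun s => (a s).proj (o s)) * Q.multiTimeState t).trace.re =
      ∑ x : Fin t → X, (∏ s, bornProb (a s).basis (Q.emit (x s)) (o s)) * Q.wordProb x := by
  rw [multiTimeState, Matrix.mul_sum, Matrix.trace_sum, Complex.re_sum]
  refine Finset.sum_congr rfl fun x _ => ?_
  rw [Matrix.mul_smul, Matrix.trace_smul, trace_tensor_mul]
  simp_rw [Action.trace_proj_mul _ (Q.emit_density _).1.isHermitian, Action.outcome_eq]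
  rw [← Complex.ofReal_prod, smul_eq_mul, ← Complex.ofReal_mul, Complex.ofReal_re, mul_comm]

theorem historyProb_eq {t : ℕ} (o : Fin t → ι) :
    Q.historyProb Λ o = mass (Q.weightedBelief Λ t o) := by
  rw [historyProb, trace_tensor_proj_mul_multiTimeState, ← sum_prod_bornProb_smul, map_sum]
  refine Finset.sum_congr rfl fun x _ => ?_
  rw [map_smul, smul_eq_mul, mass_apply, wordProb]

theorem historyProb_nonneg {t : ℕ} (o : Fin t → ι) : 0 ≤ Q.historyProb Λ o := by
  rw [historyProb_eq]
  exact mass_nonneg (Q.weightedBelief_nonneg Λ o)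

theorem belief_mem_of_historyProb_ne_zero {t : ℕ} {o : Fin t → ι} (h : Q.historyProb Λ o ≠ 0) :
    Q.belief Λ t o ∈ stdSimplex ℝ S :=
  Q.belief_mem_stdSimplex Λ (by rwa [← historyProb_eq])

/-! ### Cumulative work -/

variable (β : ℝ) (G : Action ι)

/-- The expected gain of the policy `Λ` at step `t` with optimally tuned weights. -/
noncomputable def stepGain (t : ℕ) : ℝ :=
  ∑ o : Fin t → ι, Q.gain β G (Λ t (Q.belief Λ t o)).basis (Q.weightedBelief Λ t o)

/-- The expected optimal work in `n` further steps after `t` steps with the policy `Λ`. -/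
noncomputable def expectedValue (n t : ℕ) : ℝ :=
  ∑ o : Fin t → ι, Q.value β G n (Q.weightedBelief Λ t o)

variable {β G}

/-- The Bellman inequality at each history, summed over all histories. -/
theorem stepGain_add_expectedValue_le (n t : ℕ) :
    Q.stepGain Λ β G t + Q.expectedValue Λ β G n (t + 1) ≤ Q.expectedValue Λ β G (n + 1) t := by
  rw [stepGain, expectedValue, expectedValue, sum_fin_succ_fun, ← Finset.sum_add_distrib]
  refine Finset.sum_le_sum fun o _ => ?_
  simp_rw [weightedBelief_snoc]
  exact Q.objective_le_value n _ _

/-- Optimality is assumed only on belief states; homogeneity transfers it to the weighted beliefs.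
-/
theorem stepGain_add_expectedValue_eq {n t : ℕ}
    (h : ∀ η ∈ stdSimplex ℝ S, Q.gain β G (Λ t η).basis η +
      ∑ i, Q.value β G n (Q.branch (Λ t η).basis i η) = Q.value β G (n + 1) η) :
    Q.stepGain Λ β G t + Q.expectedValue Λ β G n (t + 1) = Q.expectedValue Λ β G (n + 1) t := by
  rw [stepGain, expectedValue, expectedValue, sum_fin_succ_fun, ← Finset.sum_add_distrib]
  refine Finset.sum_congr rfl fun o _ => ?_
  simp_rw [weightedBelief_snoc]
  have hm := mass_nonneg (Q.weightedBelief_nonneg Λ o)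
  rcases eq_or_ne (mass (Q.weightedBelief Λ t o)) 0 with h0 | h0
  · rw [eq_zero_of_mass_eq_zero (Q.weightedBelief_nonneg Λ o) h0]
    simp [gain, value_zero]
  · have h1 := h _ (Q.belief_mem_stdSimplex Λ h0)
    rw [weightedBelief_eq]
    simp only [map_smul, gain_smul Q _ hm, value_smul Q _ hm, ← Finset.mul_sum, ← mul_add]
    rw [h1]

theorem expectedValue_zero_right (n : ℕ) : Q.expectedValue Λ β G n 0 = Q.value β G n Q.init := by
  simp [expectedValue, weightedBelief]

theorem expectedValue_zero_left (t : ℕ) : Q.expectedValue Λ β G 0 t = 0 := by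
  simp [expectedValue, value]

/-- The expected work of the policy `Λ` at step `t`. -/
noncomputable def stepWork (β : ℝ) (H : Matrix ι ι ℂ) (t : ℕ) : EReal :=
  ∑ o : Fin t → ι,
    (Q.historyProb Λ o : EReal) * Q.reward β H (Q.belief Λ t o) (Λ t (Q.belief Λ t o))

theorem work_eq_sum_stepWork (β : ℝ) (H : Matrix ι ι ℂ) (T : ℕ) :
    Q.work β H T Λ = ∑ t ∈ Finset.range T, Q.stepWork Λ β H t := rfl

variable {H : Matrix ι ι ℂ}

theorem stepWork_le (hβ : 0 < β) (hG : G.state = gibbs β H) (hG0 : ∀ i, 0 < G.weight i) (t : ℕ) :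
    Q.stepWork Λ β H t ≤ (Q.stepGain Λ β G t : EReal) := by
  rw [stepWork, stepGain, EReal.coe_finset_sum]
  refine Finset.sum_le_sum fun o _ => ?_
  have hm := mass_nonneg (Q.weightedBelief_nonneg Λ o)
  rw [historyProb_eq]
  rcases eq_or_ne (mass (Q.weightedBelief Λ t o)) 0 with h0 | h0
  · rw [h0, eq_zero_of_mass_eq_zero (Q.weightedBelief_nonneg Λ o) h0]
    simp [gain]
  · conv_rhs => rw [weightedBelief_eq, gain_smul Q _ hm, EReal.coe_mul]
    exact mul_le_mul_of_nonneg_left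
      (Q.reward_le_gain hβ hG hG0 (Q.belief_mem_stdSimplex Λ h0) _) (EReal.coe_nonneg.2 hm)

theorem stepWork_eq {t : ℕ} (h : ∀ η ∈ stdSimplex ℝ S,
      Q.reward β H η (Λ t η) = (Q.gain β G (Λ t η).basis η : EReal)) :
    Q.stepWork Λ β H t = (Q.stepGain Λ β G t : EReal) := by
  rw [stepWork, stepGain, EReal.coe_finset_sum]
  refine Finset.sum_congr rfl fun o _ => ?_
  have hm := mass_nonneg (Q.weightedBelief_nonneg Λ o)
  rw [historyProb_eq]
  rcases eq_or_ne (mass (Q.weightedBelief Λ t o)) 0 with h0 | h0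
  · rw [h0, eq_zero_of_mass_eq_zero (Q.weightedBelief_nonneg Λ o) h0]
    simp [gain]
  · conv_rhs => rw [weightedBelief_eq, gain_smul Q _ hm, EReal.coe_mul]
    rw [h _ (Q.belief_mem_stdSimplex Λ h0)]

/-- The Bellman inequalities telescope. The extra `n` steps are needed for the induction and later
give superadditivity in the horizon. -/
theorem sum_stepGain_add_expectedValue_le (T n : ℕ) :
    ∑ t ∈ Finset.range T, Q.stepGain Λ β G t + Q.expectedValue Λ β G n T ≤
      Q.value β G (T + n) Q.init := by
  induction T generalizing n with
  | zero => simp [expectedValue_zero_right]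
  | succ T ih =>
    rw [Finset.sum_range_succ]
    have h1 := Q.stepGain_add_expectedValue_le (β := β) (G := G) Λ n T
    have h2 := ih (n + 1)
    rw [show T + 1 + n = T + (n + 1) by ring]
    linarith

theorem work_le_value (hβ : 0 < β) (hG : G.state = gibbs β H) (hG0 : ∀ i, 0 < G.weight i)
    (T : ℕ) : Q.work β H T Λ ≤ (Q.value β G T Q.init : EReal) := by
  have h := Q.sum_stepGain_add_expectedValue_le (β := β) (G := G) Λ T 0
  rw [expectedValue_zero_left, add_zero, add_zero] at h
  rw [work_eq_sum_stepWork]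
  refine (Finset.sum_le_sum fun t _ => Q.stepWork_le Λ hβ hG hG0 t).trans ?_
  rw [← EReal.coe_finset_sum]
  exact EReal.coe_le_coe_iff.2 h

/-- A Bellman-optimal action with `n` steps remaining after the current one. -/
theorem exists_optimalAction (hG : G.state = gibbs β H) (hG0 : ∀ i, 0 < G.weight i) :
    ∃ π : ℕ → (S → ℝ) → Action ι, ∀ n, ∀ η ∈ stdSimplex ℝ S,
      Q.reward β H η (π n η) = (Q.gain β G (π n η).basis η : EReal) ∧
      Q.gain β G (π n η).basis η + ∑ i, Q.value β G n (Q.branch (π n η).basis i η) =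
        Q.value β G (n + 1) η := by
  have h : ∀ n η, ∃ a : Action ι, η ∈ stdSimplex ℝ S →
      Q.reward β H η a = (Q.gain β G a.basis η : EReal) ∧
      Q.gain β G a.basis η + ∑ i, Q.value β G n (Q.branch a.basis i η) =
        Q.value β G (n + 1) η := by
    intro n η
    by_cases hη : η ∈ stdSimplex ℝ S
    · obtain ⟨U, hU⟩ := Q.exists_objective_eq_value (β := β) (G := G) n η
      exact ⟨Q.tunedAction U hη, fun _ => ⟨Q.reward_tunedAction hG hG0 hη U, hU⟩⟩
    · obtain ⟨a⟩ := Q.nonempty_action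
      exact ⟨a, fun h => absurd h hη⟩
  choose π hπ using h
  exact ⟨π, hπ⟩

theorem exists_isDPPolicy (hβ : 0 < β) (hG : G.state = gibbs β H) (hG0 : ∀ i, 0 < G.weight i)
    (T : ℕ) : ∃ Λ, Q.IsDPPolicy β H T Λ := by
  obtain ⟨π, hπ⟩ := Q.exists_optimalAction hG hG0
  refine ⟨fun t η => π (T - 1 - t) η, fun t _ η hη a => ?_⟩
  obtain ⟨h1, h2⟩ := hπ (T - 1 - t) η hη
  rw [Q.objective_eq hβ hG hG0 _ hη (π _ η), h1, ← EReal.coe_add, h2,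
    ← Q.dpValue_eq_value hβ hG hG0 _ η hη]
  exact le_iSup (fun a => Q.objective β H (Q.dpValue β H (T - 1 - t)) η a) a

variable {Λ}

/-- The chain value ≤ reward plus continuation ≤ gain plus continuation ≤ value collapses. Hence the
basis is Bellman-optimal and the weights are optimal for it; an infinite loss is impossible because
the value is real. -/
theorem IsDPPolicy.optimal (hβ : 0 < β) (hG : G.state = gibbs β H) (hG0 : ∀ i, 0 < G.weight i)
    {T : ℕ} (h : Q.IsDPPolicy β H T Λ) {t : ℕ} (ht : t < T) {η : S → ℝ}
    (hη : η ∈ stdSimplex ℝ S) :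
    Q.reward β H η (Λ t η) = (Q.gain β G (Λ t η).basis η : EReal) ∧
      Q.gain β G (Λ t η).basis η + ∑ i, Q.value β G (T - 1 - t) (Q.branch (Λ t η).basis i η) =
        Q.value β G (T - 1 - t + 1) η := by
  have h1 : (Q.value β G (T - 1 - t + 1) η : EReal) ≤
      Q.objective β H (Q.dpValue β H (T - 1 - t)) η (Λ t η) := by
    rw [← Q.dpValue_eq_value hβ hG hG0 _ η hη]
    exact iSup_le (h t ht η hη)
  rw [Q.objective_eq hβ hG hG0 _ hη] at h1
  have h2 := Q.reward_le_gain hβ hG hG0 hη (Λ t η)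
  have h3 := Q.objective_le_value (β := β) (G := G) (T - 1 - t) (Λ t η).basis η
  have h4 := h1.trans (add_le_add_left h2 _)
  rw [← EReal.coe_add, EReal.coe_le_coe_iff] at h4
  refine ⟨le_antisymm h2 ?_, le_antisymm h3 h4⟩
  rcases eq_or_ne (Q.reward β H η (Λ t η)) ⊥ with hb | hb
  · rw [hb, EReal.bot_add] at h1
    exact absurd h1 (not_le.2 (EReal.bot_lt_coe _))
  · have ht' : Q.reward β H η (Λ t η) ≠ ⊤ := ne_top_of_le_ne_top (EReal.coe_ne_top _) h2
    lift Q.reward β H η (Λ t η) to ℝ using ⟨ht', hb⟩ with r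
    rw [← EReal.coe_add, EReal.coe_le_coe_iff] at h1
    rw [EReal.coe_le_coe_iff]
    linarith

theorem IsDPPolicy.work_eq (hβ : 0 < β) (hG : G.state = gibbs β H) (hG0 : ∀ i, 0 < G.weight i)
    {T : ℕ} (h : Q.IsDPPolicy β H T Λ) :
    Q.work β H T Λ = (Q.value β G T Q.init : EReal) := by
  have hstep : ∀ t ≤ T, ∑ s ∈ Finset.range t, Q.stepGain Λ β G s +
      Q.expectedValue Λ β G (T - t) t = Q.value β G T Q.init := by
    intro t
    induction t with
    | zero => intro _; simp [expectedValue_zero_right]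
    | succ t ih =>
      intro ht
      -- With steps indexed from 0, exactly `T - 1 - t` steps remain after step `t`.
      rw [Finset.sum_range_succ, add_assoc, show T - (t + 1) = T - 1 - t by omega,
        Q.stepGain_add_expectedValue_eq Λ
          fun η hη => (IsDPPolicy.optimal Q hβ hG hG0 h (by omega) hη).2,
        show T - 1 - t + 1 = T - t by omega]
      exact ih (by omega)
  have h1 := hstep T le_rfl
  rw [Nat.sub_self, expectedValue_zero_left, add_zero] at h1
  rw [work_eq_sum_stepWork, ← h1, EReal.coe_finset_sum]
  refine Finset.sum_congr rfl fun t ht => Q.stepWork_eq Λ fun η hη => ?_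
  exact (IsDPPolicy.optimal Q hβ hG hG0 h (Finset.mem_range.1 ht) hη).1

theorem timeOrderedFreeEnergy_eq (hβ : 0 < β) (hG : G.state = gibbs β H)
    (hG0 : ∀ i, 0 < G.weight i) (T : ℕ) :
    Q.timeOrderedFreeEnergy β H T = (Q.value β G T Q.init : EReal) := by
  apply le_antisymm
  · exact iSup_le fun Λ => Q.work_le_value Λ hβ hG hG0 T
  · obtain ⟨Λ, hΛ⟩ := Q.exists_isDPPolicy hβ hG hG0 T
    rw [← IsDPPolicy.work_eq Q hβ hG hG0 hΛ]
    exact le_iSup (fun Λ => Q.work β H T Λ) Λ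

theorem expectedState_isDensity {η : S → ℝ} (hη : η ∈ stdSimplex ℝ S) :
    IsDensity (Q.expectedState η) := by
  refine ⟨Q.expectedState_posSemidef hη.1, ?_⟩
  have h1 : ∑ x, Q.symbolProb η x = 1 := by
    have h := Q.mass_vecMul_sum η
    rw [Matrix.vecMul_sum, map_sum, mass_of_mem_stdSimplex hη] at h
    exact h
  rw [expectedState, Matrix.trace_sum]
  simp_rw [Matrix.trace_smul, (Q.emit_density _).2, smul_eq_mul, mul_one]
  rw [← Complex.ofReal_sum, h1, Complex.ofReal_one]

theorem relEntropy_state_nonneg {κ : Type*} [Fintype κ] [DecidableEq κ] {ρ : Matrix κ κ ℂ}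
    (hρ : IsDensity ρ) (a : Action κ) : 0 ≤ relEntropy ρ a.state := by
  by_cases h : ∀ i, a.weight i = 0 → a.outcome ρ i = 0
  · rw [relEntropy_state a hρ.1 h]
    exact EReal.coe_nonneg.2 (sub_nonneg.2 (sum_outcome_mul_log_le hρ a h))
  · rw [relEntropy_state_eq_top a hρ.1 h]
    exact le_top

/-- Tailoring to the expected state itself gives zero dissipation, the minimum by Klein's
inequality. -/
theorem exists_isLocallyOptimizing (Q : QuantumHMM S X ι) : ∃ Λ, Q.IsLocallyOptimizing Λ := by
  have h : ∀ η, ∃ a : Action ι, η ∈ stdSimplex ℝ S → Q.dissipation η a = 0 := by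
    intro η
    by_cases hη : η ∈ stdSimplex ℝ S
    · have hρ := Q.expectedState_isDensity hη
      obtain ⟨a, ha, ho⟩ := exists_action_state_eq hρ
      refine ⟨a, fun _ => ?_⟩
      rw [dissipation, ha, relEntropy, if_pos fun v hv => hv, sub_self, Matrix.mul_zero,
        Matrix.trace_zero, Complex.zero_re, EReal.coe_zero]
    · obtain ⟨a⟩ := Q.nonempty_action
      exact ⟨a, fun h => absurd h hη⟩
  choose A hA using h
  refine ⟨fun _ => A, fun t η hη a => ?_⟩
  rw [hA η hη]
  exact relEntropy_state_nonneg (Q.expectedState_isDensity hη) a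

end QuantumHMM

/-! ### Tensor products of states. -/

section Tensor

variable {ι : Type*} [Fintype ι] [DecidableEq ι] {T : ℕ}

theorem tensor_mul_tensor (A B : Fin T → Matrix ι ι ℂ) :
    tensor A * tensor B = tensor fun t => A t * B t := by
  ext i j
  simp only [tensor, Matrix.mul_apply, Matrix.of_apply, ← Finset.prod_mul_distrib]
  rw [Fintype.prod_sum]

theorem trace_tensor (A : Fin T → Matrix ι ι ℂ) : (tensor A).trace = ∏ t, (A t).trace := by
  simp only [Matrix.trace, Matrix.diag, tensor, Matrix.of_apply]
  rw [Fintype.prod_sum]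

theorem tensor_conjTranspose (A : Fin T → Matrix ι ι ℂ) :
    (tensor A)ᴴ = tensor fun t => (A t)ᴴ := by
  ext i j
  simp [tensor, Matrix.conjTranspose_apply]

/-- Write each factor as `Bᴴ * B` through its spectral decomposition; the tensor product inherits
this form. -/
theorem tensor_posSemidef {A : Fin T → Matrix ι ι ℂ} (hA : ∀ t, (A t).PosSemidef) :
    (tensor A).PosSemidef := by
  have h : ∀ t, ∃ B : Matrix ι ι ℂ, A t = Bᴴ * B := fun t => by
    have hh := (hA t).isHermitian
    refine ⟨Matrix.diagonal (fun i => ((√(hh.eigenvalues i) : ℝ) : ℂ)) *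
      (hh.eigenvectorUnitary : Matrix ι ι ℂ)ᴴ, ?_⟩
    rw [Matrix.conjTranspose_mul, Matrix.conjTranspose_conjTranspose,
      Matrix.diagonal_conjTranspose, Matrix.mul_assoc, ← Matrix.mul_assoc (Matrix.diagonal _),
      Matrix.diagonal_mul_diagonal, ← Matrix.mul_assoc]
    conv_lhs => rw [spectral_decomposition hh]
    congr 4
    funext i
    rw [Pi.star_apply, RCLike.star_def, Complex.conj_ofReal, ← Complex.ofReal_mul,
      Real.mul_self_sqrt ((hA t).eigenvalues_nonneg i)]
  choose B hB using h
  have h1 : tensor A = (tensor B)ᴴ * tensor B := by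
    rw [tensor_conjTranspose, tensor_mul_tensor]
    congr 1
    funext t
    exact hB t
  rw [h1]
  exact Matrix.posSemidef_conjTranspose_mul_self _

theorem tensor_isDensity {A : Fin T → Matrix ι ι ℂ} (hA : ∀ t, IsDensity (A t)) :
    IsDensity (tensor A) := by
  refine ⟨tensor_posSemidef fun t => (hA t).1, ?_⟩
  rw [trace_tensor]
  exact Finset.prod_eq_one fun t _ => (hA t).2

theorem Action.state_apply {κ : Type*} [Fintype κ] [DecidableEq κ] (a : Action κ) (i j : κ) :
    a.state i j = ∑ k, (a.basis : Matrix κ κ ℂ) i k * (a.weight k : ℂ) *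
      star ((a.basis : Matrix κ κ ℂ) j k) := by
  rw [Action.state, Matrix.mul_apply]
  simp_rw [Matrix.mul_diagonal, Matrix.conjTranspose_apply]

end Tensor

/-! ### The multi-time state and the nonequilibrium free energy bound. -/

namespace QuantumHMM

variable {S X ι : Type*} [Fintype S] [DecidableEq S] [Fintype X] [Fintype ι] [DecidableEq ι]
  (Q : QuantumHMM S X ι)

/-- The product of the transition matrices along a word. -/
def wordMatrix {t : ℕ} (x : Fin t → X) : Matrix S S ℝ := (List.ofFn fun s => Q.trans (x s)).prod

theorem wordProb_eq_mass {t : ℕ} (x : Fin t → X) :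
    Q.wordProb x = mass (Q.init ᵥ* Q.wordMatrix x) := rfl

theorem wordMatrix_snoc {t : ℕ} (x : Fin t → X) (y : X) :
    Q.wordMatrix (Fin.snoc x y : Fin (t + 1) → X) = Q.wordMatrix x * Q.trans y := by
  rw [wordMatrix, List.ofFn_succ', List.concat_eq_append, List.prod_append, List.prod_singleton]
  simp only [Fin.snoc_castSucc, Fin.snoc_last]
  rfl

theorem wordMatrix_append {m n : ℕ} (x : Fin m → X) (y : Fin n → X) :
    Q.wordMatrix (Fin.append x y) = Q.wordMatrix x * Q.wordMatrix y := by
  have h : (fun s => Q.trans (Fin.append x y s)) =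
      Fin.append (fun s => Q.trans (x s)) fun s => Q.trans (y s) := by
    funext s
    refine Fin.addCases (fun i => ?_) (fun i => ?_) s <;> simp
  rw [wordMatrix, h, List.ofFn_fin_append, List.prod_append]
  rfl

theorem sum_wordMatrix (t : ℕ) : ∑ x : Fin t → X, Q.wordMatrix x = (∑ x, Q.trans x) ^ t := by
  induction t with
  | zero => simp [wordMatrix]
  | succ t ih =>
    rw [sum_fin_succ_fun]
    simp_rw [wordMatrix_snoc]
    simp_rw [← Finset.mul_sum]
    rw [← Finset.sum_mul, ih, pow_succ]

theorem vecMul_wordMatrix_nonneg {v : S → ℝ} (hv : 0 ≤ v) {t : ℕ} (x : Fin t → X) :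
    0 ≤ v ᵥ* Q.wordMatrix x := by
  induction t with
  | zero => simpa [wordMatrix] using hv
  | succ t ih =>
    rw [← Fin.snoc_init_self x, wordMatrix_snoc, ← Matrix.vecMul_vecMul]
    exact Q.vecMul_trans_nonneg (ih _) _

theorem mass_vecMul_pow (v : S → ℝ) (t : ℕ) : mass (v ᵥ* (∑ x, Q.trans x) ^ t) = mass v := by
  induction t with
  | zero => simp
  | succ t ih => rw [pow_succ, ← Matrix.vecMul_vecMul, mass_vecMul_sum, ih]

theorem sum_mass_vecMul_wordMatrix (v : S → ℝ) (t : ℕ) :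
    ∑ x : Fin t → X, mass (v ᵥ* Q.wordMatrix x) = mass v := by
  rw [← map_sum, ← Matrix.vecMul_sum, sum_wordMatrix, mass_vecMul_pow]

theorem wordProb_nonneg {t : ℕ} (x : Fin t → X) : 0 ≤ Q.wordProb x :=
  mass_nonneg (Q.vecMul_wordMatrix_nonneg Q.init_mem.1 x)

theorem multiTimeState_isDensity (T : ℕ) : IsDensity (Q.multiTimeState T) := by
  constructor
  · refine Matrix.posSemidef_sum _ fun x _ =>
      (tensor_posSemidef fun t => (Q.emit_density _).1).smul ?_
    exact_mod_cast Q.wordProb_nonneg x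
  · have h := Q.sum_mass_vecMul_wordMatrix Q.init T
    rw [mass_of_mem_stdSimplex Q.init_mem] at h
    rw [multiTimeState, Matrix.trace_sum]
    simp_rw [Matrix.trace_smul, (tensor_isDensity fun t => Q.emit_density _).2, smul_eq_mul,
      mul_one]
    rw [← Complex.ofReal_sum, ← Complex.ofReal_one, ← h]
    rfl

/-! ### The adaptive product basis of a policy -/

variable (Λ : Policy S ι)

/-- The orthonormal basis of product vectors in which a policy measures `T` subsystems. -/
noncomputable def treeBasis (T : ℕ) : Matrix.unitaryGroup (Fin T → ι) ℂ :=
  ⟨Matrix.of fun k o => ∏ s, ((Q.actionAt Λ o s).basis : Matrix ι ι ℂ) (k s) (o s), by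
    rw [Matrix.mem_unitaryGroup_iff']
    ext o o'
    have h1 : (star (Matrix.of fun (k o : Fin T → ι) =>
          ∏ s, ((Q.actionAt Λ o s).basis : Matrix ι ι ℂ) (k s) (o s)) *
        Matrix.of fun (k o : Fin T → ι) =>
          ∏ s, ((Q.actionAt Λ o s).basis : Matrix ι ι ℂ) (k s) (o s)) o o' =
        ∏ s, (star ((Q.actionAt Λ o s).basis : Matrix ι ι ℂ) *
          ((Q.actionAt Λ o' s).basis : Matrix ι ι ℂ)) (o s) (o' s) := by
      simp only [Matrix.mul_apply, Matrix.star_apply, Matrix.of_apply, star_prod,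
        ← Finset.prod_mul_distrib]
      rw [Fintype.prod_sum]
    rw [h1]
    by_cases ho : o = o'
    · subst ho
      rw [Matrix.one_apply_eq]
      refine Finset.prod_eq_one fun s _ => ?_
      rw [Unitary.star_mul_self_of_mem (Q.actionAt Λ o s).basis.2, Matrix.one_apply_eq]
    · rw [Matrix.one_apply_ne ho]
      -- The overlap factorizes over the subsystems. At the first index where the histories differ
      -- the same action is taken, since it depends only on earlier outcomes, and the two basis
      -- vectors there are orthogonal.
      obtain ⟨s, hs, hmin⟩ := WellFounded.has_min (wellFounded_lt (α := Fin T))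
        {s | o s ≠ o' s} (Function.ne_iff.1 ho)
      refine Finset.prod_eq_zero (Finset.mem_univ s) ?_
      have h2 : Q.actionAt Λ o s = Q.actionAt Λ o' s := by
        unfold actionAt
        congr 2
        funext k
        by_contra hk
        exact hmin ⟨k, k.2.trans s.2⟩ hk (Fin.lt_def.2 k.2)
      rw [h2, Unitary.star_mul_self_of_mem (Q.actionAt Λ o' s).basis.2, Matrix.one_apply_ne hs]⟩

theorem treeBasis_apply (T : ℕ) (k o : Fin T → ι) :
    (Q.treeBasis Λ T : Matrix (Fin T → ι) (Fin T → ι) ℂ) k o =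
      ∏ s, ((Q.actionAt Λ o s).basis : Matrix ι ι ℂ) (k s) (o s) := rfl

theorem outcome_multiTimeState {T : ℕ} {a : Action (Fin T → ι)} (ha : a.basis = Q.treeBasis Λ T)
    (o : Fin T → ι) : a.outcome (Q.multiTimeState T) o = Q.historyProb Λ o := by
  rw [Action.outcome, historyProb]
  congr 3
  ext i j
  rw [Action.proj, ha]
  simp only [Matrix.vecMulVec_apply, treeBasis_apply, tensor, Matrix.of_apply, Action.proj,
    star_prod, Finset.prod_mul_distrib]

/-- Measuring in an adaptive product basis does not decrease the entropy. -/
theorem sum_historyProb_mul_log_le (T : ℕ) :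
    ∑ o : Fin T → ι, Q.historyProb Λ o * Real.log (Q.historyProb Λ o) ≤
      negEntropy (Q.multiTimeState T) := by
  have hw : (fun o : Fin T → ι => Q.historyProb Λ o) ∈ stdSimplex ℝ (Fin T → ι) := by
    refine ⟨fun o => Q.historyProb_nonneg Λ o, ?_⟩
    simp_rw [historyProb_eq]
    exact Q.sum_mass_weightedBelief Λ T
  have h := sum_outcome_mul_log_le (Q.multiTimeState_isDensity T)
    ⟨Q.treeBasis Λ T, fun o => Q.historyProb Λ o, hw⟩
  have ho := Q.outcome_multiTimeState Λ
    (a := ⟨Q.treeBasis Λ T, fun o => Q.historyProb Λ o, hw⟩) rfl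
  simp only [ho] at h
  exact h fun o ho => ho

variable {β : ℝ} {G : Action ι}

/-- Chain rule for Shannon entropy: the term `-m log m` of each history cancels the contribution of
the preceding level, leaving the entropy of the full record. The energy is linear, so it sees only
the averaged belief. -/
theorem sum_stepGain (T : ℕ) :
    ∑ t ∈ Finset.range T, Q.stepGain Λ β G t =
      β⁻¹ * (∑ t ∈ Finset.range T, Q.energy G (Q.init ᵥ* (∑ x, Q.trans x) ^ t) +
        ∑ o : Fin T → ι, Q.historyProb Λ o * Real.log (Q.historyProb Λ o)) := by
  simp_rw [historyProb_eq]
  induction T with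
  | zero => simp [weightedBelief, mass_of_mem_stdSimplex Q.init_mem]
  | succ T ih =>
    rw [Finset.sum_range_succ, ih, Finset.sum_range_succ, sum_fin_succ_fun,
      ← Q.sum_weightedBelief Λ T, map_sum, stepGain]
    simp_rw [weightedBelief_snoc, gain]
    rw [← Finset.mul_sum, Finset.sum_add_distrib, Finset.sum_sub_distrib]
    ring

/-- Computes `tr ρ ln γ^{⊗T}` with the machinery of histories: measuring every factor in the
eigenbasis of `γ` is the constant policy `G`. -/
theorem sum_historyProb_mul_sum_log (T : ℕ) :
    ∑ o : Fin T → ι, Q.historyProb (fun _ _ => G) o * ∑ s, Real.log (G.weight (o s)) =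
      -∑ t ∈ Finset.range T, Q.energy G (Q.init ᵥ* (∑ x, Q.trans x) ^ t) := by
  simp_rw [historyProb_eq]
  induction T with
  | zero => simp
  | succ T ih =>
    rw [Finset.sum_range_succ, neg_add, ← ih, sum_fin_succ_fun,
      ← Q.sum_weightedBelief (fun _ _ => G) T, map_sum, ← Finset.sum_neg_distrib,
      ← Finset.sum_add_distrib]
    refine Finset.sum_congr rfl fun o _ => ?_
    simp_rw [weightedBelief_snoc, Fin.sum_univ_castSucc, Fin.snoc_castSucc, Fin.snoc_last, mul_add,
      Finset.sum_add_distrib, energy_apply, neg_neg]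
    rw [← Finset.sum_mul, sum_mass_branch]

/-- The tailored state of independent copies of an action is a tensor power. -/
theorem exists_action_state_eq_tensor (G : Action ι) (T : ℕ) :
    ∃ a : Action (Fin T → ι), a.basis = Q.treeBasis (fun _ _ => G) T ∧
      (∀ o, a.weight o = ∏ s, G.weight (o s)) ∧ a.state = tensor fun _ => G.state := by
  refine ⟨⟨Q.treeBasis (fun _ _ => G) T, fun o => ∏ s, G.weight (o s),
    fun o => Finset.prod_nonneg fun s _ => G.weight_mem.1 _, ?_⟩, rfl, fun _ => rfl, ?_⟩
  · rw [← Fintype.prod_sum fun (_ : Fin T) i => G.weight i, G.weight_mem.2, Finset.prod_const_one]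
  · ext i j
    simp only [Action.state_apply, tensor, Matrix.of_apply, treeBasis_apply, star_prod,
      Complex.ofReal_prod, ← Finset.prod_mul_distrib]
    rw [Fintype.prod_sum]
    rfl

variable {H : Matrix ι ι ℂ}

theorem relEntropy_multiTimeState (hG : G.state = gibbs β H) (hG0 : ∀ i, 0 < G.weight i) (T : ℕ) :
    relEntropy (Q.multiTimeState T) (tensor fun _ => gibbs β H) =
      ((negEntropy (Q.multiTimeState T) +
        ∑ t ∈ Finset.range T, Q.energy G (Q.init ᵥ* (∑ x, Q.trans x) ^ t) : ℝ) : EReal) := by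
  obtain ⟨a, ha, hw, hs⟩ := Q.exists_action_state_eq_tensor G T
  have hw0 : ∀ o, 0 < a.weight o := fun o => by
    rw [hw]
    exact Finset.prod_pos fun s _ => hG0 _
  rw [← hG, ← hs, relEntropy_state a (Q.multiTimeState_isDensity T).1
    fun o ho => absurd ho (hw0 o).ne']
  simp_rw [Q.outcome_multiTimeState _ ha, hw, Real.log_prod fun s _ => (hG0 _).ne']
  rw [sum_historyProb_mul_sum_log, sub_neg_eq_add]

theorem noneqFreeEnergy_eq (hG : G.state = gibbs β H) (hG0 : ∀ i, 0 < G.weight i) (T : ℕ) :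
    Q.noneqFreeEnergy β H T = ((T * eqFreeEnergy β H +
      β⁻¹ * (negEntropy (Q.multiTimeState T) +
        ∑ t ∈ Finset.range T, Q.energy G (Q.init ᵥ* (∑ x, Q.trans x) ^ t)) : ℝ) : EReal) := by
  rw [noneqFreeEnergy, Q.relEntropy_multiTimeState hG hG0, ← EReal.coe_mul, ← EReal.coe_add]

/-- Run a dynamic-programming policy. Its work is bounded by its tuned gains, hence by energy and
record entropy, and the record is a measurement of the multi-time state. -/
theorem value_le (hβ : 0 < β) (hG : G.state = gibbs β H) (hG0 : ∀ i, 0 < G.weight i) (T : ℕ) :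
    Q.value β G T Q.init ≤ β⁻¹ * (negEntropy (Q.multiTimeState T) +
      ∑ t ∈ Finset.range T, Q.energy G (Q.init ᵥ* (∑ x, Q.trans x) ^ t)) := by
  obtain ⟨Λ, hΛ⟩ := Q.exists_isDPPolicy hβ hG hG0 T
  have h1 := IsDPPolicy.work_eq Q hβ hG hG0 hΛ
  have h2 : Q.work β H T Λ ≤ ((∑ t ∈ Finset.range T, Q.stepGain Λ β G t : ℝ) : EReal) := by
    rw [EReal.coe_finset_sum, work_eq_sum_stepWork]
    exact Finset.sum_le_sum fun t _ => Q.stepWork_le Λ hβ hG hG0 t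
  rw [h1, EReal.coe_le_coe_iff, sum_stepGain] at h2
  refine h2.trans (mul_le_mul_of_nonneg_left ?_ (inv_nonneg.2 hβ.le))
  have := Q.sum_historyProb_mul_log_le Λ T
  linarith

end QuantumHMM

theorem sum_fin_add_fun {α M : Type*} [Fintype α] [AddCommMonoid M] {m n : ℕ}
    (F : (Fin (m + n) → α) → M) :
    ∑ o, F o = ∑ p : Fin m → α, ∑ q : Fin n → α, F (Fin.append p q) := by
  rw [← Fintype.sum_equiv (Fin.appendEquiv m n) (fun p => F (Fin.append p.1 p.2)) F
    fun p => rfl, Fintype.sum_prod_type]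

theorem coe_bornProb {κ : Type*} [Fintype κ] [DecidableEq κ] (U : Matrix.unitaryGroup κ ℂ)
    {ρ : Matrix κ κ ℂ} (hρ : ρ.IsHermitian) (i : κ) :
    (bornProb U ρ i : ℂ) = ((U : Matrix κ κ ℂ)ᴴ * ρ * (U : Matrix κ κ ℂ)) i i :=
  (Matrix.isHermitian_conjTranspose_mul_mul _ hρ).coe_re_apply_self i

/-! ### Measurements on two blocks of subsystems. -/

section ProductBasis

variable {ι : Type*} [Fintype ι] [DecidableEq ι] {m n : ℕ}

/-- The product of two matrices acting on disjoint blocks of tensor factors. -/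
def blockTensor (A : Matrix (Fin m → ι) (Fin m → ι) ℂ) (B : Matrix (Fin n → ι) (Fin n → ι) ℂ) :
    Matrix (Fin (m + n) → ι) (Fin (m + n) → ι) ℂ :=
  Matrix.of fun k o => A (fun i => k (Fin.castAdd n i)) (fun i => o (Fin.castAdd n i)) *
    B (fun i => k (Fin.natAdd m i)) (fun i => o (Fin.natAdd m i))

theorem blockTensor_append (A : Matrix (Fin m → ι) (Fin m → ι) ℂ)
    (B : Matrix (Fin n → ι) (Fin n → ι) ℂ) (i j : Fin m → ι) (k l : Fin n → ι) :
    blockTensor A B (Fin.append i k) (Fin.append j l) = A i j * B k l := by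
  simp [blockTensor]

theorem blockTensor_ext {M N : Matrix (Fin (m + n) → ι) (Fin (m + n) → ι) ℂ}
    (h : ∀ i j k l, M (Fin.append i k) (Fin.append j l) = N (Fin.append i k) (Fin.append j l)) :
    M = N := by
  ext o o'
  obtain ⟨⟨i, k⟩, rfl⟩ := (Fin.appendEquiv m n).surjective o
  obtain ⟨⟨j, l⟩, rfl⟩ := (Fin.appendEquiv m n).surjective o'
  exact h i j k l

theorem blockTensor_mul (A A' : Matrix (Fin m → ι) (Fin m → ι) ℂ)
    (B B' : Matrix (Fin n → ι) (Fin n → ι) ℂ) :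
    blockTensor A B * blockTensor A' B' = blockTensor (A * A') (B * B') := by
  refine blockTensor_ext fun i j k l => ?_
  rw [blockTensor_append, Matrix.mul_apply, sum_fin_add_fun, Matrix.mul_apply, Matrix.mul_apply,
    Finset.sum_mul_sum]
  simp_rw [blockTensor_append]
  exact Finset.sum_congr rfl fun p _ => Finset.sum_congr rfl fun q _ => by ring

theorem blockTensor_conjTranspose (A : Matrix (Fin m → ι) (Fin m → ι) ℂ)
    (B : Matrix (Fin n → ι) (Fin n → ι) ℂ) :
    (blockTensor A B)ᴴ = blockTensor Aᴴ Bᴴ := by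
  ext o o'
  simp [blockTensor, Matrix.conjTranspose_apply]

theorem blockTensor_one :
    blockTensor (1 : Matrix (Fin m → ι) (Fin m → ι) ℂ) (1 : Matrix (Fin n → ι) (Fin n → ι) ℂ) =
      1 := by
  refine blockTensor_ext fun i j k l => ?_
  rw [blockTensor_append, Matrix.one_apply, Matrix.one_apply, Matrix.one_apply]
  have h : Fin.append i k = Fin.append j l ↔ i = j ∧ k = l :=
    (Fin.appendEquiv m n).injective.eq_iff (a := (i, k)) (b := (j, l)) |>.trans Prod.mk_inj
  simp only [h, ite_and]
  split_ifs <;> simp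

theorem blockTensor_tensor (A : Fin m → Matrix ι ι ℂ) (B : Fin n → Matrix ι ι ℂ) :
    blockTensor (tensor A) (tensor B) = tensor (Fin.append A B) := by
  ext o o'
  simp [blockTensor, tensor, Fin.prod_univ_add]

/-- The product basis of two bases. -/
def blockUnitary (U : Matrix.unitaryGroup (Fin m → ι) ℂ) (V : Matrix.unitaryGroup (Fin n → ι) ℂ) :
    Matrix.unitaryGroup (Fin (m + n) → ι) ℂ :=
  ⟨blockTensor U V, by
    rw [Matrix.mem_unitaryGroup_iff', Matrix.star_eq_conjTranspose, blockTensor_conjTranspose,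
      blockTensor_mul, ← Matrix.star_eq_conjTranspose, ← Matrix.star_eq_conjTranspose,
      Unitary.star_mul_self_of_mem U.2, Unitary.star_mul_self_of_mem V.2, blockTensor_one]⟩

theorem coe_blockUnitary (U : Matrix.unitaryGroup (Fin m → ι) ℂ)
    (V : Matrix.unitaryGroup (Fin n → ι) ℂ) :
    (blockUnitary U V : Matrix (Fin (m + n) → ι) (Fin (m + n) → ι) ℂ) = blockTensor U V := rfl

theorem bornProb_blockUnitary (U : Matrix.unitaryGroup (Fin m → ι) ℂ)
    (V : Matrix.unitaryGroup (Fin n → ι) ℂ) {ρ : Matrix (Fin m → ι) (Fin m → ι) ℂ}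
    {σ : Matrix (Fin n → ι) (Fin n → ι) ℂ} (hρ : ρ.IsHermitian) (hσ : σ.IsHermitian)
    (p : Fin m → ι) (q : Fin n → ι) :
    bornProb (blockUnitary U V) (blockTensor ρ σ) (Fin.append p q) =
      bornProb U ρ p * bornProb V σ q := by
  have h : (blockTensor ρ σ).IsHermitian := by
    rw [Matrix.IsHermitian, blockTensor_conjTranspose, hρ.eq, hσ.eq]
  apply Complex.ofReal_injective
  rw [Complex.ofReal_mul, coe_bornProb _ h, coe_bornProb _ hρ, coe_bornProb _ hσ,
    coe_blockUnitary, blockTensor_conjTranspose, blockTensor_mul, blockTensor_mul, blockTensor_append]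

/-- The product action on two blocks of subsystems. -/
def blockAction (a : Action (Fin m → ι)) (b : Action (Fin n → ι)) : Action (Fin (m + n) → ι) where
  basis := blockUnitary a.basis b.basis
  weight o := a.weight (fun i => o (Fin.castAdd n i)) * b.weight (fun i => o (Fin.natAdd m i))
  weight_mem := by
    refine ⟨fun o => mul_nonneg (a.weight_mem.1 _) (b.weight_mem.1 _), ?_⟩
    rw [sum_fin_add_fun]
    simp only [Fin.append_left, Fin.append_right]
    rw [← Finset.sum_mul_sum, a.weight_mem.2, b.weight_mem.2, one_mul]

end ProductBasis

/-! ### Stationarity and subadditivity of the entropy. -/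

namespace QuantumHMM

variable {S X ι : Type*} [Fintype S] [DecidableEq S] [Fintype X] [Fintype ι] [DecidableEq ι]
  (Q : QuantumHMM S X ι)

theorem IsStationary.vecMul_pow {Q : QuantumHMM S X ι} (hQ : Q.IsStationary) (t : ℕ) :
    Q.init ᵥ* (∑ x, Q.trans x) ^ t = Q.init := by
  induction t with
  | zero => simp
  | succ t ih => rw [pow_succ, ← Matrix.vecMul_vecMul, ih, hQ]

theorem sum_wordProb_append_right {m : ℕ} (n : ℕ) (x : Fin m → X) :
    ∑ y : Fin n → X, Q.wordProb (Fin.append x y) = Q.wordProb x := by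
  simp_rw [wordProb_eq_mass, wordMatrix_append, ← Matrix.vecMul_vecMul]
  exact Q.sum_mass_vecMul_wordMatrix _ n

/-- Forgetting the past needs stationarity, unlike forgetting the future, which follows from
stochasticity alone. -/
theorem IsStationary.sum_wordProb_append_left {Q : QuantumHMM S X ι} (hQ : Q.IsStationary) (m : ℕ)
    {n : ℕ} (y : Fin n → X) :
    ∑ x : Fin m → X, Q.wordProb (Fin.append x y) = Q.wordProb y := by
  simp_rw [wordProb_eq_mass, wordMatrix_append, ← Matrix.vecMul_vecMul]
  rw [← map_sum, ← Matrix.sum_vecMul, ← Matrix.vecMul_sum, sum_wordMatrix, hQ.vecMul_pow]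

theorem outcome_multiTimeState_eq {T : ℕ} (a : Action (Fin T → ι)) (o : Fin T → ι) :
    a.outcome (Q.multiTimeState T) o =
      ∑ x : Fin T → X, Q.wordProb x * bornProb a.basis (tensor fun t => Q.emit (x t)) o := by
  rw [a.outcome_eq, multiTimeState, bornProb_sum]

theorem tensor_emit_isDensity {T : ℕ} (x : Fin T → X) : IsDensity (tensor fun t => Q.emit (x t)) :=
  tensor_isDensity fun _ => Q.emit_density _

theorem outcome_blockAction {m n : ℕ} (a : Action (Fin m → ι)) (b : Action (Fin n → ι))
    (p : Fin m → ι) (q : Fin n → ι) :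
    (blockAction a b).outcome (Q.multiTimeState (m + n)) (Fin.append p q) =
      ∑ x : Fin m → X, ∑ y : Fin n → X, Q.wordProb (Fin.append x y) *
        (bornProb a.basis (tensor fun t => Q.emit (x t)) p *
          bornProb b.basis (tensor fun t => Q.emit (y t)) q) := by
  rw [outcome_multiTimeState_eq, sum_fin_add_fun]
  refine Finset.sum_congr rfl fun x _ => Finset.sum_congr rfl fun y _ => ?_
  have h : (tensor fun t => Q.emit (Fin.append x y t)) =
      blockTensor (tensor fun t => Q.emit (x t)) (tensor fun t => Q.emit (y t)) := by
    rw [blockTensor_tensor]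
    congr 1
    funext s
    refine Fin.addCases (fun i => ?_) (fun i => ?_) s <;> simp
  rw [h, ← bornProb_blockUnitary _ _ (Q.tensor_emit_isDensity x).1.isHermitian
    (Q.tensor_emit_isDensity y).1.isHermitian]
  rfl

theorem sum_bornProb_tensor_emit {T : ℕ} (U : Matrix.unitaryGroup (Fin T → ι) ℂ) (x : Fin T → X) :
    ∑ o, bornProb U (tensor fun t => Q.emit (x t)) o = 1 := by
  rw [sum_bornProb, (Q.tensor_emit_isDensity x).2, Complex.one_re]

theorem sum_outcome_blockAction_right {m n : ℕ} (a : Action (Fin m → ι)) (b : Action (Fin n → ι))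
    (p : Fin m → ι) :
    ∑ q, (blockAction a b).outcome (Q.multiTimeState (m + n)) (Fin.append p q) =
      a.outcome (Q.multiTimeState m) p := by
  simp_rw [outcome_blockAction]
  rw [outcome_multiTimeState_eq, Finset.sum_comm]
  refine Finset.sum_congr rfl fun x _ => ?_
  rw [Finset.sum_comm, ← Q.sum_wordProb_append_right n x, Finset.sum_mul]
  refine Finset.sum_congr rfl fun y _ => ?_
  rw [← Finset.mul_sum, ← Finset.mul_sum, sum_bornProb_tensor_emit, mul_one]

theorem IsStationary.sum_outcome_blockAction_left {Q : QuantumHMM S X ι} (hQ : Q.IsStationary)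
    {m n : ℕ} (a : Action (Fin m → ι)) (b : Action (Fin n → ι)) (q : Fin n → ι) :
    ∑ p, (blockAction a b).outcome (Q.multiTimeState (m + n)) (Fin.append p q) =
      b.outcome (Q.multiTimeState n) q := by
  simp_rw [outcome_blockAction]
  rw [outcome_multiTimeState_eq, Finset.sum_comm]
  have h : ∀ y : Fin n → X, Q.wordProb y * bornProb b.basis (tensor fun t => Q.emit (y t)) q =
      ∑ x : Fin m → X, Q.wordProb (Fin.append x y) *
        bornProb b.basis (tensor fun t => Q.emit (y t)) q := fun y => by
    rw [← Finset.sum_mul, hQ.sum_wordProb_append_left]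
  simp_rw [h]
  rw [Finset.sum_comm (s := (Finset.univ : Finset (Fin n → X)))]
  refine Finset.sum_congr rfl fun x _ => ?_
  rw [Finset.sum_comm]
  refine Finset.sum_congr rfl fun y _ => ?_
  rw [← Finset.mul_sum, ← Finset.sum_mul, sum_bornProb_tensor_emit, one_mul]

/-- Subadditivity of the entropy of the multi-time state of a stationary process. -/
theorem IsStationary.negEntropy_add_le {Q : QuantumHMM S X ι} (hQ : Q.IsStationary) (m n : ℕ) :
    negEntropy (Q.multiTimeState m) + negEntropy (Q.multiTimeState n) ≤
      negEntropy (Q.multiTimeState (m + n)) := by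
  obtain ⟨a, ha, hao⟩ := exists_action_state_eq (Q.multiTimeState_isDensity m)
  obtain ⟨b, hb, hbo⟩ := exists_action_state_eq (Q.multiTimeState_isDensity n)
  -- Joint outcome law in the product of the two eigenbases. Its marginals are the spectra of the
  -- two block states, so Klein's inequality against the product weights is subadditivity.
  set P : (Fin m → ι) → (Fin n → ι) → ℝ := fun p q =>
    (blockAction a b).outcome (Q.multiTimeState (m + n)) (Fin.append p q) with hP
  have hP0 : ∀ p q, 0 ≤ P p q := fun p q => by
    simp only [hP, Action.outcome_eq]
    exact bornProb_nonneg _ (Q.multiTimeState_isDensity (m + n)).1 _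
  have hPa : ∀ p, ∑ q, P p q = a.weight p := fun p => by
    rw [← hao p, ← Q.sum_outcome_blockAction_right a b p]
  have hPb : ∀ q, ∑ p, P p q = b.weight q := fun q => by
    rw [← hbo q, ← hQ.sum_outcome_blockAction_left a b q]
  have hPa0 : ∀ p q, a.weight p = 0 → P p q = 0 := fun p q h => by
    rw [← hPa, Finset.sum_eq_zero_iff_of_nonneg fun q _ => hP0 p q] at h
    exact h q (Finset.mem_univ q)
  have hPb0 : ∀ p q, b.weight q = 0 → P p q = 0 := fun p q h => by
    rw [← hPb, Finset.sum_eq_zero_iff_of_nonneg fun p _ => hP0 p q] at h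
    exact h p (Finset.mem_univ p)
  have hw : ∀ p q, (blockAction a b).weight (Fin.append p q) = a.weight p * b.weight q := by
    intro p q
    simp [blockAction]
  have hsupp : ∀ o, (blockAction a b).weight o = 0 →
      (blockAction a b).outcome (Q.multiTimeState (m + n)) o = 0 := by
    intro o ho
    obtain ⟨⟨p, q⟩, rfl⟩ := (Fin.appendEquiv m n).surjective o
    rcases mul_eq_zero.1 ((hw p q).symm.trans ho) with h | h
    · exact hPa0 p q h
    · exact hPb0 p q h
  have hK := sum_outcome_mul_log_le (Q.multiTimeState_isDensity (m + n)) (blockAction a b) hsupp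
  refine le_trans (le_of_eq ?_) hK
  rw [negEntropy_eq_of_state ha hao, negEntropy_eq_of_state hb hbo, sum_fin_add_fun]
  have hterm : ∀ p q, P p q * Real.log (a.weight p * b.weight q) =
      P p q * Real.log (a.weight p) + P p q * Real.log (b.weight q) := by
    intro p q
    by_cases h1 : a.weight p = 0
    · simp [hPa0 p q h1]
    by_cases h2 : b.weight q = 0
    · simp [hPb0 p q h2]
    rw [Real.log_mul h1 h2, mul_add]
  simp_rw [hw]
  change _ = ∑ p, ∑ q, P p q * Real.log (a.weight p * b.weight q)
  simp_rw [hterm, Finset.sum_add_distrib, ← Finset.sum_mul, hPa]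
  congr 1
  rw [Finset.sum_comm]
  simp_rw [← Finset.sum_mul, hPb]

end QuantumHMM

theorem EReal.coe_div_natCast (x : ℝ) (T : ℕ) :
    (x : EReal) / (T : EReal) = ((x / T : ℝ) : EReal) := by
  rw [← EReal.coe_coe_eq_natCast, ← EReal.coe_div]

/-! ### Asymptotic rates. -/

namespace QuantumHMM

variable {S X ι : Type*} [Fintype S] [DecidableEq S] [Fintype X] [Fintype ι] [DecidableEq ι]
  {Q : QuantumHMM S X ι} {β : ℝ} {G : Action ι} {H : Matrix ι ι ℂ}

/-- Acting optimally for horizon `n` from time `s` on collects the full optimal value of the beliefs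
held at time `s`: the Bellman equalities telescope within the block. -/
theorem sum_stepGain_block {Λ : Policy S ι} (n s : ℕ)
    (h : ∀ j < n, ∀ η ∈ stdSimplex ℝ S, Q.gain β G (Λ (s + j) η).basis η +
      ∑ i, Q.value β G (n - 1 - j) (Q.branch (Λ (s + j) η).basis i η) =
        Q.value β G (n - 1 - j + 1) η) :
    ∑ j ∈ Finset.range n, Q.stepGain Λ β G (s + j) = Q.expectedValue Λ β G n s := by
  induction n generalizing s with
  | zero => simp [expectedValue_zero_left]
  | succ n ih =>
    have h0 := Q.stepGain_add_expectedValue_eq Λ (h 0 n.succ_pos)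
    rw [Finset.sum_range_succ', add_comm]
    simp only [add_zero, Nat.sub_zero, Nat.add_sub_cancel] at h0 ⊢
    rw [← h0, ← ih (s + 1)]
    · congr 1
      exact Finset.sum_congr rfl fun j _ => by rw [add_right_comm, add_assoc]
    · intro j hj η hη
      have h1 := h (j + 1) (by omega) η hη
      rwa [show n + 1 - 1 - (j + 1) = n - 1 - j by omega, ← add_assoc, add_right_comm] at h1

/-- Information never hurts: by stationarity the weighted beliefs at time `t` sum to the initial
distribution, and the value is subadditive. -/
theorem IsStationary.value_le_expectedValue (hQ : Q.IsStationary) (hβ : 0 < β) (Λ : Policy S ι)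
    (n t : ℕ) : Q.value β G n Q.init ≤ Q.expectedValue Λ β G n t := by
  have h := Q.value_sum_le (G := G) hβ n Finset.univ (Q.weightedBelief Λ t)
    fun o => Q.weightedBelief_nonneg Λ o
  rwa [sum_weightedBelief, hQ.vecMul_pow] at h

/-- Act optimally for `m` steps and then for `n` more; the beliefs acquired are worth at least as
much as the initial one. -/
theorem IsStationary.value_add_value_le (hQ : Q.IsStationary) (hβ : 0 < β)
    (hG : G.state = gibbs β H) (hG0 : ∀ i, 0 < G.weight i) (m n : ℕ) :
    Q.value β G m Q.init + Q.value β G n Q.init ≤ Q.value β G (m + n) Q.init := by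
  obtain ⟨π, hπ⟩ := Q.exists_optimalAction hG hG0
  have h1 := sum_stepGain_block (Q := Q) (β := β) (G := G) (Λ := fun t η => π (m - 1 - t) η) m 0
    fun j _ η hη => by simpa using (hπ (m - 1 - j) η hη).2
  have h2 := Q.sum_stepGain_add_expectedValue_le (β := β) (G := G)
    (fun t η => π (m - 1 - t) η) m n
  have h3 := hQ.value_le_expectedValue (G := G) hβ (fun t η => π (m - 1 - t) η) n m
  simp only [zero_add, expectedValue_zero_right] at h1
  linarith

theorem IsStationary.sum_energy (hQ : Q.IsStationary) (T : ℕ) :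
    ∑ t ∈ Finset.range T, Q.energy G (Q.init ᵥ* (∑ x, Q.trans x) ^ t) =
      T * Q.energy G Q.init := by
  simp [hQ.vecMul_pow]

theorem IsStationary.exists_tendsto_negEntropy (hQ : Q.IsStationary) :
    ∃ h : ℝ, Tendsto (fun T : ℕ => negEntropy (Q.multiTimeState T) / T) atTop (𝓝 h) := by
  have hs : Subadditive fun T => -negEntropy (Q.multiTimeState T) := fun m n => by
    have := hQ.negEntropy_add_le m n
    linarith
  refine ⟨-hs.lim, ?_⟩
  have h := (hs.tendsto_lim ⟨0, ?_⟩).neg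
  · simpa [neg_div] using h
  · rintro _ ⟨T, rfl⟩
    exact div_nonneg (neg_nonneg.2 (negEntropy_nonpos (Q.multiTimeState_isDensity T)))
      T.cast_nonneg

theorem IsStationary.exists_tendsto_value (hQ : Q.IsStationary) (hβ : 0 < β)
    (hG : G.state = gibbs β H) (hG0 : ∀ i, 0 < G.weight i) :
    ∃ f : ℝ, Tendsto (fun T : ℕ => Q.value β G T Q.init / T) atTop (𝓝 f) := by
  have hs : Subadditive fun T => -Q.value β G T Q.init := fun m n => by
    have := hQ.value_add_value_le hβ hG hG0 m n
    linarith
  refine ⟨-hs.lim, ?_⟩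
  -- Entropy is nonnegative, so the work per step is at most `β⁻¹` times the mean energy. The
  -- absolute value also covers `T = 0`, where the quotient is 0.
  have h := (hs.tendsto_lim ⟨-|β⁻¹ * Q.energy G Q.init|, ?_⟩).neg
  · simpa [neg_div] using h
  · rintro _ ⟨T, rfl⟩
    have h1 := Q.value_le hβ hG hG0 T
    have h2 := negEntropy_nonpos (Q.multiTimeState_isDensity T)
    rw [hQ.sum_energy] at h1
    have h3 : Q.value β G T Q.init ≤ |β⁻¹ * Q.energy G Q.init| * T := by
      have h4 : β⁻¹ * negEntropy (Q.multiTimeState T) ≤ 0 :=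
        mul_nonpos_of_nonneg_of_nonpos (inv_nonneg.2 hβ.le) h2
      have h5 := mul_le_mul_of_nonneg_right (le_abs_self (β⁻¹ * Q.energy G Q.init))
        (Nat.cast_nonneg (α := ℝ) T)
      linarith
    rcases T.eq_zero_or_pos with rfl | hT
    · simpa using mul_nonneg (abs_nonneg β⁻¹) (abs_nonneg (Q.energy G Q.init))
    · have hT' : (0 : ℝ) < T := Nat.cast_pos.2 hT
      change _ ≤ -Q.value β G T Q.init / T
      rw [neg_div]
      exact neg_le_neg ((div_le_iff₀ hT').2 h3)

/-- A policy that plans ahead optimally in blocks `[k², (k+1)²)` has the optimal rate. -/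
theorem IsStationary.exists_policy_tendsto (hQ : Q.IsStationary) (hβ : 0 < β)
    (hG : G.state = gibbs β H) (hG0 : ∀ i, 0 < G.weight i) {f : ℝ}
    (hf : Tendsto (fun T : ℕ => Q.value β G T Q.init / T) atTop (𝓝 f)) :
    ∃ Λ : Policy S ι, Tendsto (fun T : ℕ => Q.work β H T Λ / (T : EReal)) atTop
      (𝓝 (f : EReal)) := by
  obtain ⟨π, hπ⟩ := Q.exists_optimalAction hG hG0
  -- At time `t` in `[k², (k+1)²)` the agent plans up to the end of the block; the subscript of `π`
  -- counts the steps left after the current one.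
  set Λ : Policy S ι := fun t η => π ((Nat.sqrt t + 1) * (Nat.sqrt t + 1) - 1 - t) η with hΛ
  refine ⟨Λ, ?_⟩
  set w : ℕ → ℝ := fun T => ∑ t ∈ Finset.range T, Q.stepGain Λ β G t with hw
  have hwork : ∀ T, Q.work β H T Λ = (w T : EReal) := by
    intro T
    rw [work_eq_sum_stepWork, hw, EReal.coe_finset_sum]
    exact Finset.sum_congr rfl fun t _ => Q.stepWork_eq Λ fun η hη => (hπ _ η hη).1
  simp_rw [hwork, EReal.coe_div_natCast]
  rw [EReal.tendsto_coe]
  have hupper : ∀ T, w T ≤ Q.value β G T Q.init := by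
    intro T
    simpa [expectedValue_zero_left] using
      Q.sum_stepGain_add_expectedValue_le (β := β) (G := G) Λ T 0
  -- A complete block has `2k + 1` steps and earns at least the optimal work from a fresh start.
  have hblock : ∀ k : ℕ, w (k * k) + Q.value β G (2 * k + 1) Q.init ≤ w ((k + 1) * (k + 1)) := by
    intro k
    have h1 := sum_stepGain_block (Q := Q) (β := β) (G := G) (Λ := Λ) (2 * k + 1) (k * k) ?_
    · have h2 := hQ.value_le_expectedValue (G := G) hβ Λ (2 * k + 1) (k * k)
      have h3 : w (k * k + (2 * k + 1)) = w (k * k) +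
        ∑ j ∈ Finset.range (2 * k + 1), Q.stepGain Λ β G (k * k + j) := Finset.sum_range_add _ _ _
      rw [show (k + 1) * (k + 1) = k * k + (2 * k + 1) by ring, h3]
      linarith
    · intro j hj η hη
      have hs : Nat.sqrt (k * k + j) = k := Nat.sqrt_add_eq k (by omega)
      have hr : (k + 1) * (k + 1) - 1 - (k * k + j) = 2 * k + 1 - 1 - j := by
        rw [show (k + 1) * (k + 1) = k * k + (2 * k + 1) by ring]
        omega
      simp only [hΛ, hs, hr]
      exact (hπ _ η hη).2
  obtain ⟨C, hC0, hC⟩ := Q.exists_gain_ge (β := β) (G := G)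
  have hstep : ∀ t, -C ≤ Q.stepGain Λ β G t := by
    intro t
    rw [stepGain, ← mul_one (-C), ← Q.sum_mass_weightedBelief Λ t, Finset.mul_sum]
    exact Finset.sum_le_sum fun o _ => hC _ _ (Q.weightedBelief_nonneg Λ o)
  have hlower : ∀ a < f, ∃ M : ℝ, 0 ≤ M ∧ ∀ T : ℕ, T * a - Nat.sqrt T * M ≤ w T := by
    intro a ha
    obtain ⟨N, hN⟩ := eventually_atTop.1 ((tendsto_order.1 hf).1 a ha)
    -- A single constant bounding the deficit `n a - value n` for every `n`: only the finitely many
    -- horizons up to `N` can fall short of rate `a`.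
    set K := ∑ n ∈ Finset.range (N + 1), |Q.value β G n Q.init - n * a| with hK
    have hval : ∀ n : ℕ, n * a - K ≤ Q.value β G n Q.init := by
      intro n
      rcases le_or_gt n N with hn | hn
      · have h1 := Finset.single_le_sum (f := fun n : ℕ => |Q.value β G n Q.init - n * a|)
          (fun i _ => abs_nonneg _) (Finset.mem_range.2 (Nat.lt_succ_of_le hn))
        have h2 := neg_abs_le (Q.value β G n Q.init - n * a)
        linarith
      · have hn' : (0 : ℝ) < n := Nat.cast_pos.2 (by omega)
        have h1 := (lt_div_iff₀ hn').1 (hN n hn.le)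
        have h2 : 0 ≤ K := Finset.sum_nonneg fun i _ => abs_nonneg _
        linarith
    have hsq : ∀ k : ℕ, (k * k : ℕ) * a - k * K ≤ w (k * k) := by
      intro k
      induction k with
      | zero => simp [hw]
      | succ k ih =>
        have h1 := hblock k
        have h2 := hval (2 * k + 1)
        push_cast at *
        linarith
    have hK0 : 0 ≤ K := Finset.sum_nonneg fun i _ => abs_nonneg _
    -- With `k = √T` rounded down, the `k` complete blocks cost at most `K` each. The unfinished
    -- block has at most `2k` steps, each missing at most `|a|` and losing at most `C`.
    refine ⟨2 * |a| + K + 2 * C, by positivity, fun T => ?_⟩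
    obtain ⟨j, hj⟩ := Nat.exists_eq_add_of_le (Nat.sqrt_le T)
    set k := Nat.sqrt T with hk
    have hj2 : j ≤ 2 * k := by
      have := Nat.sqrt_le_add T
      rw [← hk] at this
      omega
    have hj2' : (j : ℝ) ≤ 2 * k := by exact_mod_cast hj2
    have h1 : w (k * k) - j * C ≤ w T := by
      have h2 : ∑ i ∈ Finset.range j, (-C) ≤
          ∑ i ∈ Finset.range j, Q.stepGain Λ β G (k * k + i) :=
        Finset.sum_le_sum fun i _ => hstep _
      rw [Finset.sum_const, Finset.card_range, nsmul_eq_mul] at h2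
      have h3 : w (k * k + j) = w (k * k) +
        ∑ i ∈ Finset.range j, Q.stepGain Λ β G (k * k + i) := Finset.sum_range_add _ _ _
      rw [hj, h3]
      linarith
    have h2 := hsq k
    have h3 : (T : ℝ) = (k * k : ℕ) + j := by exact_mod_cast hj
    have h4 : (j : ℝ) * a ≤ 2 * k * |a| :=
      (mul_le_mul_of_nonneg_left (le_abs_self a) j.cast_nonneg).trans
        (mul_le_mul_of_nonneg_right hj2' (abs_nonneg a))
    have h5 : (j : ℝ) * C ≤ 2 * k * C := mul_le_mul_of_nonneg_right hj2' hC0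
    rw [h3]
    linarith
  refine tendsto_order.2 ⟨fun a ha => ?_, fun a ha => ?_⟩
  · obtain ⟨b, hab, hbf⟩ := exists_between ha
    obtain ⟨M, hM0, hM⟩ := hlower b hbf
    obtain ⟨N, hN⟩ := exists_nat_gt (M / (b - a))
    filter_upwards [eventually_ge_atTop ((N + 1) * (N + 1))] with T hT
    have hk : N + 1 ≤ Nat.sqrt T := Nat.le_sqrt.2 hT
    have hT0 : (0 : ℝ) < T := Nat.cast_pos.2 (lt_of_lt_of_le (by positivity) hT)
    rw [lt_div_iff₀ hT0]
    -- The loss of order `√T` is beaten by the slack `(b - a) T` once `√T` exceeds `M / (b - a)`.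
    have h1 : M < (b - a) * Nat.sqrt T := by
      rw [div_lt_iff₀ (sub_pos.2 hab)] at hN
      have h2 : (N : ℝ) ≤ Nat.sqrt T := by exact_mod_cast (by omega : N ≤ Nat.sqrt T)
      nlinarith [sub_pos.2 hab]
    have h2 : (Nat.sqrt T : ℝ) * Nat.sqrt T ≤ T := by exact_mod_cast Nat.sqrt_le T
    have h3 : (0 : ℝ) < Nat.sqrt T := Nat.cast_pos.2 (by omega)
    have h4 := mul_lt_mul_of_pos_left h1 h3
    have h5 := mul_le_mul_of_nonneg_left h2 (sub_pos.2 hab).le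
    have h6 := hM T
    linarith
  · filter_upwards [(tendsto_order.1 hf).2 a ha] with T hT
    exact (div_le_div_of_nonneg_right (hupper T) T.cast_nonneg).trans_lt hT

theorem workRate_le (hβ : 0 < β) (hG : G.state = gibbs β H) (hG0 : ∀ i, 0 < G.weight i) {f : ℝ}
    (hf : Tendsto (fun T : ℕ => Q.value β G T Q.init / T) atTop (𝓝 f)) (Λ : Policy S ι) :
    Q.workRate β H Λ ≤ (f : EReal) := by
  have h1 : Tendsto (fun T : ℕ => ((Q.value β G T Q.init / T : ℝ) : EReal)) atTop
    (𝓝 (f : EReal)) := EReal.tendsto_coe.2 hf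
  rw [workRate, ← h1.limsup_eq]
  refine limsup_le_limsup (Eventually.of_forall fun T => ?_)
  change _ ≤ ((Q.value β G T Q.init / T : ℝ) : EReal)
  rw [← EReal.coe_div_natCast]
  exact EReal.div_le_div_right_of_nonneg (Nat.cast_nonneg' T) (Q.work_le_value Λ hβ hG hG0 T)

/-- For a stationary policy whose belief process has a finite limiting distribution, the work rate
converges to the stationary mean of the reward. -/
theorem tendsto_work_div_of_hasLimitingBeliefs (hβ : 0 < β) (hG : G.state = gibbs β H)
    (hG0 : ∀ i, 0 < G.weight i) (A : (S → ℝ) → Action ι) (B : Finset (S → ℝ)) (μ : (S → ℝ) → ℝ)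
    (hB : Q.HasLimitingBeliefs (fun _ => A) B μ) (hW : ∀ T, Q.work β H T (fun _ => A) ≠ ⊥) :
    Tendsto (fun T : ℕ => Q.work β H T (fun _ => A) / (T : EReal)) atTop
      (𝓝 (∑ η ∈ B, (μ η : EReal) * Q.reward β H η (A η))) := by
  classical
  set Λ : Policy S ι := fun _ => A with hΛ
  set R : (S → ℝ) → ℝ := fun η => (Q.reward β H η (A η)).toReal with hR
  -- An infinite loss on a history of positive probability would make the work `⊥` from the next
  -- horizon on, since `⊥` absorbs every summand.
  have hreal : ∀ t (o : Fin t → ι), Q.historyProb Λ o ≠ 0 →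
      Q.reward β H (Q.belief Λ t o) (A (Q.belief Λ t o)) = (R (Q.belief Λ t o) : EReal) := by
    intro t o h0
    have hle := Q.reward_le_gain hβ hG hG0 (Q.belief_mem_of_historyProb_ne_zero Λ h0)
      (A (Q.belief Λ t o))
    refine (EReal.coe_toReal (ne_top_of_le_ne_top (EReal.coe_ne_top _) hle) fun hbot => ?_).symm
    apply hW (t + 1)
    have hstep : Q.stepWork Λ β H t = ⊥ := by
      rw [stepWork, ← Finset.add_sum_erase _ _ (Finset.mem_univ o)]
      simp only [hΛ] at hbot ⊢
      rw [hbot, EReal.coe_mul_bot_of_pos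
        (lt_of_le_of_ne (Q.historyProb_nonneg Λ o) (Ne.symm h0)), EReal.bot_add]
    rw [work_eq_sum_stepWork, Finset.sum_range_succ, hstep, EReal.add_bot]
  have hmem : ∀ t (o : Fin t → ι), Q.historyProb Λ o ≠ 0 → Q.belief Λ t o ∈ B := by
    intro t o h0
    by_contra hn
    have h1 := hB.1 t _ hn
    rw [beliefLaw, Finset.sum_eq_zero_iff_of_nonneg] at h1
    · have h2 := h1 o (Finset.mem_univ o)
      rw [if_pos rfl] at h2
      exact h0 h2
    · intro o' _
      split_ifs
      exacts [Q.historyProb_nonneg Λ o', le_rfl]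
  have hstep : ∀ t, Q.stepWork Λ β H t = ((∑ η ∈ B, Q.beliefLaw Λ t η * R η : ℝ) : EReal) := by
    intro t
    have h1 : ∀ o : Fin t → ι, (Q.historyProb Λ o : EReal) *
        Q.reward β H (Q.belief Λ t o) (Λ t (Q.belief Λ t o)) =
          ((∑ η ∈ B, (if Q.belief Λ t o = η then Q.historyProb Λ o else 0) * R η : ℝ) :
            EReal) := by
      intro o
      rcases eq_or_ne (Q.historyProb Λ o) 0 with h0 | h0
      · simp [h0]
      · rw [Finset.sum_eq_single_of_mem _ (hmem t o h0)
          fun η _ hη => by rw [if_neg (Ne.symm hη), zero_mul], if_pos rfl, EReal.coe_mul,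
          ← hreal t o h0]
    rw [stepWork]
    simp_rw [h1]
    rw [← EReal.coe_finset_sum, Finset.sum_comm]
    simp_rw [← Finset.sum_mul]
    rfl
  -- A belief never visited with positive probability has limiting weight 0, so a reward `⊥` there
  -- contributes `0 * ⊥ = 0`.
  have hμ : ∀ η ∈ B, (μ η : EReal) * Q.reward β H η (A η) = ((μ η * R η : ℝ) : EReal) := by
    intro η hη
    by_cases h : ∃ t, Q.beliefLaw Λ t η ≠ 0
    · obtain ⟨t, ht⟩ := h
      obtain ⟨o, _, ho⟩ := Finset.exists_ne_zero_of_sum_ne_zero ht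
      split_ifs at ho with hb
      · have h1 := hreal t o ho
        rw [hb] at h1
        rw [h1, EReal.coe_mul]
      · exact absurd rfl ho
    · push Not at h
      have h1 := hB.2 η hη
      simp_rw [h] at h1
      rw [tendsto_nhds_unique h1 tendsto_const_nhds]
      simp
  rw [Finset.sum_congr rfl hμ, ← EReal.coe_finset_sum]
  simp_rw [work_eq_sum_stepWork, hstep, ← EReal.coe_finset_sum, EReal.coe_div_natCast]
  rw [EReal.tendsto_coe]
  have h1 : Tendsto (fun t => ∑ η ∈ B, Q.beliefLaw Λ t η * R η) atTop
      (𝓝 (∑ η ∈ B, μ η * R η)) := tendsto_finsetSum _ fun η hη => (hB.2 η hη).mul_const _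
  -- The expected reward at step `t` converges, hence so do its Cesàro means.
  simpa only [div_eq_inv_mul] using h1.cesaro

end QuantumHMM

end TimeOrderedWork

/-! ### The hierarchy. -/

open TimeOrderedWork in
theorem mainTheorem3 {S X ι : Type*} [Fintype S] [DecidableEq S] [Fintype X]
    [Fintype ι] [DecidableEq ι] (β : ℝ) (hβ : 0 < β)
    (H : Matrix ι ι ℂ) (hH : H.IsHermitian) (Q : QuantumHMM S X ι) :
    -- locally optimizing policies exist
    (∃ Λ_LO, Q.IsLocallyOptimizing Λ_LO) ∧
    -- cumulative work
    (∀ T : ℕ,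
      (∃ Λ_opt, Q.IsDPPolicy β H T Λ_opt) ∧
      Q.timeOrderedFreeEnergy β H T
        ≤ Q.noneqFreeEnergy β H T - ((T * eqFreeEnergy β H : ℝ) : EReal) ∧
      ∀ Λ_opt, Q.IsDPPolicy β H T Λ_opt →
        Q.timeOrderedFreeEnergy β H T = Q.work β H T Λ_opt ∧
        ∀ Λ_LO, Q.IsLocallyOptimizing Λ_LO → Q.work β H T Λ_LO ≤ Q.work β H T Λ_opt) ∧
    -- asymptotic rates
    (Q.IsStationary → ∃ f_noneq f_TO : ℝ,
      Tendsto (fun T : ℕ => Q.noneqFreeEnergy β H T / (T : EReal)) atTop (𝓝 (f_noneq : EReal)) ∧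
      Tendsto (fun T : ℕ => Q.timeOrderedFreeEnergy β H T / (T : EReal)) atTop
        (𝓝 (f_TO : EReal)) ∧
      f_TO ≤ f_noneq - eqFreeEnergy β H ∧
      -- the finite-horizon optimal policies achieve the rate `f_TO`
      (∀ Λ_opt : ℕ → Policy S ι, (∀ T, Q.IsDPPolicy β H T (Λ_opt T)) →
        Tendsto (fun T : ℕ => Q.work β H T (Λ_opt T) / (T : EReal)) atTop
          (𝓝 (f_TO : EReal))) ∧
      -- a single policy achieves the rate `f_TO` as a limit, and it is rate-optimal
      (∃ Λ_opt, Q.IsRateOptimal β H Λ_opt ∧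
        Tendsto (fun T : ℕ => Q.work β H T Λ_opt / (T : EReal)) atTop (𝓝 (f_TO : EReal))) ∧
      ∀ Λ_opt, Q.IsRateOptimal β H Λ_opt →
        Q.workRate β H Λ_opt = (f_TO : EReal) ∧
        ∀ Λ_LO, Q.IsLocallyOptimizing Λ_LO → Q.workRate β H Λ_LO ≤ Q.workRate β H Λ_opt) ∧
    -- for a stationary policy with a finite limiting belief process the rate is the stationary mean
    (∀ (A : (S → ℝ) → Action ι) (B : Finset (S → ℝ)) (μ : (S → ℝ) → ℝ),
      Q.HasLimitingBeliefs (fun _ => A) B μ → (∀ T, Q.work β H T (fun _ => A) ≠ ⊥) →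
        Tendsto (fun T : ℕ => Q.work β H T (fun _ => A) / (T : EReal)) atTop
          (𝓝 (∑ η ∈ B, (μ η : EReal) * Q.reward β H η (A η)))) := by
  -- Weights summing to 1 need a nonempty index set; this makes the partition function positive.
  have hι : Nonempty ι := by
    obtain ⟨a⟩ := Q.nonempty_action
    by_contra h
    rw [not_nonempty_iff] at h
    simpa using a.weight_mem.2
  obtain ⟨G, hG, hG0⟩ := exists_action_state_eq_gibbs β hH
  refine ⟨Q.exists_isLocallyOptimizing, fun T => ⟨Q.exists_isDPPolicy hβ hG hG0 T, ?_, ?_⟩,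
    fun hQ => ?_, fun A B μ hB hW =>
      QuantumHMM.tendsto_work_div_of_hasLimitingBeliefs hβ hG hG0 A B μ hB hW⟩
  · rw [Q.timeOrderedFreeEnergy_eq hβ hG hG0, Q.noneqFreeEnergy_eq hG hG0, ← EReal.coe_sub,
      EReal.coe_le_coe_iff, add_sub_cancel_left]
    exact Q.value_le hβ hG hG0 T
  · intro Λ hΛ
    have h := (Q.timeOrderedFreeEnergy_eq hβ hG hG0 T).trans
      (QuantumHMM.IsDPPolicy.work_eq Q hβ hG hG0 hΛ).symm
    refine ⟨h, fun Λ' _ => ?_⟩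
    rw [← h]
    exact le_iSup (fun Λ => Q.work β H T Λ) Λ'
  · obtain ⟨s, hs⟩ := hQ.exists_tendsto_negEntropy
    obtain ⟨f, hf⟩ := hQ.exists_tendsto_value hβ hG hG0
    have hD : Tendsto (fun T : ℕ => β⁻¹ * (negEntropy (Q.multiTimeState T) / T +
        Q.energy G Q.init)) atTop (𝓝 (β⁻¹ * (s + Q.energy G Q.init))) :=
      (hs.add_const _).const_mul _
    -- At `T = 0` division by zero breaks this identity, which is harmless for the limits.
    have hD_eq : ∀ T : ℕ, T ≠ 0 → β⁻¹ * (negEntropy (Q.multiTimeState T) / T +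
        Q.energy G Q.init) = β⁻¹ * (negEntropy (Q.multiTimeState T) +
          T * Q.energy G Q.init) / T := by
      intro T hT
      have hT' : (T : ℝ) ≠ 0 := Nat.cast_ne_zero.2 hT
      field_simp
    have hF : Tendsto (fun T : ℕ => Q.timeOrderedFreeEnergy β H T / (T : EReal)) atTop
        (𝓝 (f : EReal)) := by
      simp_rw [Q.timeOrderedFreeEnergy_eq hβ hG hG0, EReal.coe_div_natCast]
      exact EReal.tendsto_coe.2 hf
    obtain ⟨Λ, hΛ⟩ := hQ.exists_policy_tendsto hβ hG hG0 hf
    have hΛ_rate : Q.workRate β H Λ = (f : EReal) := hΛ.limsup_eq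
    refine ⟨eqFreeEnergy β H + β⁻¹ * (s + Q.energy G Q.init), f, ?_, hF, ?_, fun Λs hΛs => ?_,
      ⟨Λ, fun Λ' => ?_, hΛ⟩, fun Λ' hΛ' => ⟨le_antisymm ?_ ?_, fun Λ'' _ => hΛ' Λ''⟩⟩
    · simp_rw [Q.noneqFreeEnergy_eq hG hG0, hQ.sum_energy, EReal.coe_div_natCast]
      rw [EReal.tendsto_coe]
      refine (hD.const_add (eqFreeEnergy β H)).congr' ?_
      filter_upwards [eventually_ne_atTop 0] with T hT
      have hT' : (T : ℝ) ≠ 0 := Nat.cast_ne_zero.2 hT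
      rw [hD_eq T hT, add_div, mul_div_cancel_left₀ _ hT']
    · rw [add_sub_cancel_left]
      refine le_of_tendsto_of_tendsto hf hD ?_
      filter_upwards [eventually_ne_atTop 0] with T hT
      rw [hD_eq T hT]
      have h := Q.value_le hβ hG hG0 T
      rw [hQ.sum_energy] at h
      exact div_le_div_of_nonneg_right h T.cast_nonneg
    · refine hF.congr fun T => ?_
      rw [Q.timeOrderedFreeEnergy_eq hβ hG hG0,
        QuantumHMM.IsDPPolicy.work_eq Q hβ hG hG0 (hΛs T)]
    · rw [hΛ_rate]
      exact QuantumHMM.workRate_le hβ hG hG0 hf Λ'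
    · exact QuantumHMM.workRate_le hβ hG hG0 hf Λ'
    · rw [← hΛ_rate]
      exact hΛ' Λ
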